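/- Let \((P_\ell)_{\ell\ge 0}\) be the Legendre polynomials, \(P_\ell(\mu)=\frac{1}{2^{\ell}\ell!}\frac{d^\ell}{d\mu^\ell}(\mu^2-1)^\ell\), and for real-valued \(u\in L^2(-1,1)\) let \(u_\ell=\int_{-1}^1 u(x)P_\ell(x)\,dx\). For \(j\in\mathbb{N}_0\) put \(|u|_{V^j}^2=\int_{-1}^1\bigl|u^{(j)}(\mu)\bigr|^2(1-\mu^2)^j\,d\mu\), where \(u^{(j)}\) is the \(j\)-th weak derivative on \((-1,1)\) (and \(|u|_{V^j}=\infty\) if \(u\) has no locally integrable \(j\)-th weak derivative). For \(n\in\mathbb{N}_0\) let \(\|u\|_{V^n}^2=\sum_{j=0}^n|u|_{V^j}^2\), and let \(V^n(-1,1)\) be the closure of the Sobolev space \(H^n(-1,1)\) with respect to \(\|\cdot\|_{V^n}\). For \(n<\eta<n+1\) let \(V^\eta(-1,1)=(V^n(-1,1),V^{n+1}(-1,1))_{\eta-n,2}\) be the real interpolation space with norm \[ \|u\|_{V^\eta}^2=\int_0^\infty t^{-2(\eta-n)}K(t,u)^2\,\frac{dt}{t},\qquad K(t,u)=\inf\bigl\{\|v\|_{V^n}+t\|w\|_{V^{n+1}}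 : u=v+w,\ v\in V^n(-1,1),\ w\in V^{n+1}(-1,1)\bigr\}. \] **Theorem.** (1) Let \(\eta\ge 0\), with the convention \(0^0=1\). For every \(u\in L^2(-1,1)\), \[ u\in V^\eta(-1,1)\iff \sum_{\ell=0}^\infty u_\ell^2\,\frac{2\ell+1}{2}\,(1+\ell^{2\eta})<\infty . \] Moreover \(V^\eta(-1,1)\) is a linear subspace of \(L^2(-1,1)\), and \(N_\eta(u)=\bigl(\sum_{\ell=0}^\infty u_\ell^2\frac{2\ell+1}{2}(1+\ell^{2\eta})\bigr)^{1/2}\) is an equivalent norm on it: it is a norm, and there are constants \(c,C>0\) depending only on \(\eta\) with \(c\,N_\eta(u)^2\le\|u\|_{V^\eta}^2\le C\,N_\eta(u)^2\) for all \(u\in V^\eta(-1,1)\). (2) Let \((A_\ell)_{\ell\ge 0}\) be nonnegative reals with \(\sum_\ell A_\ell(2\ell+1)<\infty\) (the angular power spectrum of an isotropic random field on \(\mathbb{S}^2\)), and let \(k_I(\mu)=k(\arccos\mu)\), \(k(r)=\sum_{\ell=0}^\infty A_\ell\frac{2\ell+1}{4\pi}P_\ell(\cos r)\), be its covariance kernel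 as a function of the inner product. Then \(k_I\in L^2(-1,1)\), and for every \(n\in\mathbb{N}_0\) the following are equivalent: (a) the sequence \((\ell^{n+1/2}A_\ell)_{\ell\ge n}\) is in \(\ell^2\); (b) \(\frac{1}{(4\pi)^2}\sum_{\ell\ge n}A_\ell^2\frac{2\ell+1}{2}\ell^{2n}<\infty\); (c) \(k_I\) has a locally integrable \(n\)-th weak derivative \(k_I^{(n)}\) on \((-1,1)\), and \((1-\mu^2)^{n/2}k_I^{(n)}(\mu)\) is in \(L^2(-1,1)\); (d) \(\int_{-1}^1|k_I^{(n)}(\mu)|^2(1-\mu^2)^n\,d\mu<\infty\), the integral being \(|k_I|_{V^n}^2\); (e) \(k_I\in V^n(-1,1)\). (3) The equivalence of (a)–(e) also holds for every kernel \(k_I=u\in L^2(-1,1)\), with \(A_\ell:=2\pi u_\ell\). -/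

import Mathlib

open MeasureTheory Set Filter Topology
open scoped ENNReal

noncomputable section

namespace LegendreSobolev

/-- Lebesgue measure on the open interval `(-1, 1)`. -/
abbrev volI : Measure ℝ := volume.restrict (Ioo (-1 : ℝ) 1)

/-- The real Hilbert space `L²(-1, 1)`. -/
abbrev L2I : Type := Lp ℝ 2 volI

/-- The Legendre polynomial `P_ℓ`, by Rodrigues' formula
`P_ℓ(μ) = 2^{-ℓ} (1 / ℓ!) (d/dμ)^ℓ (μ² - 1)^ℓ`. -/
def legendreP (l : ℕ) : Polynomial ℝ :=
  Polynomial.C (1 / (2 ^ l * (l.factorial : ℝ))) *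
    (Polynomial.derivative^[l] ((Polynomial.X ^ 2 - 1) ^ l))

/-- The Fourier–Legendre coefficient `u_ℓ = ∫_{-1}^1 u(x) P_ℓ(x) dx`. -/
def legendreCoeff (u : L2I) (l : ℕ) : ℝ :=
  ∫ x in Ioo (-1 : ℝ) 1, u x * (legendreP l).eval x

/-- `g` is a `j`-th weak derivative of `u` on `(-1, 1)`: both are locally integrable there and
`∫ u φ^{(j)} = (-1)^j ∫ g φ` for all smooth `φ` with compact support in `(-1, 1)`. -/
def HasWeakDeriv (j : ℕ) (u g : ℝ → ℝ) : Prop :=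
  LocallyIntegrableOn u (Ioo (-1 : ℝ) 1) ∧ LocallyIntegrableOn g (Ioo (-1 : ℝ) 1) ∧
    ∀ φ : ℝ → ℝ, ContDiff ℝ (⊤ : ℕ∞) φ → HasCompactSupport φ → tsupport φ ⊆ Ioo (-1 : ℝ) 1 →
      ∫ x in Ioo (-1 : ℝ) 1, u x * iteratedDeriv j φ x =
        (-1) ^ j * ∫ x in Ioo (-1 : ℝ) 1, g x * φ x

/-- The standard Sobolev space `H^n(-1, 1)`, as a subset of `L²(-1, 1)`. -/
def sobolevH (n : ℕ) : Set L2I :=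
  {u | ∀ j ≤ n, ∃ g : ℝ → ℝ, HasWeakDeriv j u g ∧ MemLp g 2 volI}

/-- The squared weighted seminorm `|u|²_{V^j} = ∫_{-1}^1 |u^{(j)}(μ)|² (1 - μ²)^j dμ`, where
`u^{(j)}` is the weak derivative. A weak derivative is unique up to null sets, so the infimum is
over one value, and it is `∞` when there is no (locally integrable) weak derivative. -/
def seminormSq (j : ℕ) (u : ℝ → ℝ) : ℝ≥0∞ :=
  ⨅ (g : ℝ → ℝ) (_ : HasWeakDeriv j u g),
    ∫⁻ x in Ioo (-1 : ℝ) 1, ENNReal.ofReal (g x ^ 2 * (1 - x ^ 2) ^ j)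

/-- The squared norm `‖u‖²_{V^n} = ∑_{j=0}^n |u|²_{V^j}` for integer `n`. -/
def intNormSq (n : ℕ) (u : L2I) : ℝ≥0∞ :=
  ∑ j ∈ Finset.range (n + 1), seminormSq j u

/-- The norm `‖u‖_{V^n}` for integer `n`. -/
def intNorm (n : ℕ) (u : L2I) : ℝ≥0∞ :=
  intNormSq n u ^ (1 / 2 : ℝ)

/-- `V^n(-1, 1)` for integer `n`: the closure of `H^n(-1, 1)` with respect to `‖·‖_{V^n}`, taken
among the functions of finite `V^n`-norm (which form a complete space). -/
def intV (n : ℕ) : Set L2I :=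
  {u | intNorm n u < ⊤ ∧ ∃ s : ℕ → L2I, (∀ k, s k ∈ sobolevH n) ∧
    Tendsto (fun k => intNorm n (u - s k)) atTop (𝓝 0)}

/-- The `K`-functional of the couple `(V^n, V^{n+1})`,
`K(t, u) = inf {‖v‖_{V^n} + t ‖w‖_{V^{n+1}} : u = v + w, v ∈ V^n, w ∈ V^{n+1}}`. -/
def kFunctional (n : ℕ) (t : ℝ) (u : L2I) : ℝ≥0∞ :=
  ⨅ (v ∈ intV n) (w ∈ intV (n + 1)) (_ : u = v + w),
    (intNorm n v + ENNReal.ofReal t * intNorm (n + 1) w)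

/-- The square of the norm of the real interpolation space `(V^n, V^{n+1})_{θ, 2}`,
`∫_0^∞ t^{-2θ} K(t, u)² dt / t`. -/
def interpNormSq (n : ℕ) (θ : ℝ) (u : L2I) : ℝ≥0∞ :=
  ∫⁻ t in Ioi (0 : ℝ), ENNReal.ofReal (t ^ (-2 * θ)) * kFunctional n t u ^ 2 *
    ENNReal.ofReal (1 / t)

open Classical in
/-- The squared norm of `V^η(-1, 1)`, `η ≥ 0`: the weighted Sobolev norm if `η` is an integer,
and the norm of `(V^n, V^{n+1})_{η - n, 2}` if `n < η < n + 1`. -/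
def normSqV (η : ℝ) (u : L2I) : ℝ≥0∞ :=
  if η = (⌊η⌋₊ : ℝ) then intNormSq ⌊η⌋₊ u else interpNormSq ⌊η⌋₊ (η - ⌊η⌋₊) u

open Classical in
/-- The space `V^η(-1, 1)`, `η ≥ 0`: the weighted Sobolev space if `η` is an integer, and the
real interpolation space `(V^n, V^{n+1})_{η - n, 2}` if `n < η < n + 1`. -/
def spaceV (η : ℝ) : Set L2I :=
  if η = (⌊η⌋₊ : ℝ) then intV ⌊η⌋₊ else {u | interpNormSq ⌊η⌋₊ (η - ⌊η⌋₊) u < ⊤}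

/-- The `ℓ`-th term `u_ℓ² (2ℓ+1)/2 (1 + ℓ^{2η})` of the weighted sum of squares. -/
def spectralTerm (η : ℝ) (u : L2I) (l : ℕ) : ℝ :=
  legendreCoeff u l ^ 2 * ((2 * (l : ℝ) + 1) / 2) * (1 + (l : ℝ) ^ (2 * η))

/-- The covariance kernel with angular power spectrum `A`, as a function of the spherical distance
`r ∈ [0, π]`: `k(r) = ∑_ℓ A_ℓ (2ℓ+1)/(4π) P_ℓ(cos r)`. -/
def kernelDist (A : ℕ → ℝ) (r : ℝ) : ℝ :=
  ∑' l : ℕ, A l * ((2 * (l : ℝ) + 1) / (4 * Real.pi)) * (legendreP l).eval (Real.cos r)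

/-- The covariance kernel as a function of the inner product `μ ∈ [-1, 1]`:
`k_I(μ) = k(arccos μ)`. -/
def kernelI (A : ℕ → ℝ) (μ : ℝ) : ℝ :=
  kernelDist A (Real.arccos μ)

end LegendreSobolev

end

namespace LegendreSobolev

open Polynomial

/-! Everything becomes diagonal in the Legendre basis. The `j`-times differentiated Legendre
equation in divergence form (`derivative_weight_mul_legendreP`) shows that the functions `(1 -
x²)^{j/2} P_l^{(j)}`, `l ≥ j`, are orthogonal in `L²(-1, 1)`, with squared norm `wt l j` times that
of `P_l`, where `wt l j = (l + j)! / (l - j)!`.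

Hence `|u|²_{V^j}` is the sum of the squared normalized coefficients of `u` against `wt l j`
(`seminormSq_eq_tsum`). The bound from below is Bessel's inequality: the weight kills the boundary
terms, so a weak derivative may be integrated by parts against `(1 - x²)^j` times a polynomial. The
bound from above builds the derivative as an orthogonal series. Completeness is needed only for `j =
0`, where it follows from Weierstrass approximation.

Since the weights of `‖·‖²_{V^n}` are comparable to `max(1, l)^{2n}`, and partial sums are
polynomials, `V^n` is a weighted `ℓ²` space. Splitting at frequency `1/t` is optimal up to constants
in the `K`-functional, so `K(t, u)²` is comparable to the sum of squared coefficients against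
`max(1, l)^{2n} min(1, (t max(1, l))²)`; integrating in `t` produces the exponent `2(n + θ)`
(`lintegral_specK`).

For kernels, `|P_l| ≤ 1` makes the series uniformly convergent, and termwise integration gives `A_l
= 2π u_l`. The top seminorm alone decides membership in `V^n`, because `u ∈ L²` already controls the
frequencies on which `wt l n` vanishes. -/

/-! ### Rodrigues' formula and the differentiated Legendre equation -/

theorem rodrigues_base_derivative (l : ℕ) :
    (X ^ 2 - 1 : ℝ[X]) * derivative ((X ^ 2 - 1) ^ l) = 2 * (l : ℝ[X]) * X * (X ^ 2 - 1) ^ l := by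
  cases l with
  | zero => simp
  | succ l =>
    rw [derivative_pow]
    simp only [derivative_sub, derivative_X_pow, derivative_one, Nat.add_sub_cancel, map_natCast]
    push_cast
    ring

/-- Leibniz' rule: this is the preceding first-order identity differentiated `k + 1` times. At `k =
l + j` it becomes an equation for the `j`-th derivative of `P_l`. -/
theorem rodrigues_base_iterate_derivative (l k : ℕ) :
    (X ^ 2 - 1 : ℝ[X]) * derivative^[k + 2] ((X ^ 2 - 1) ^ l) +
      2 * ((k : ℝ[X]) + 1) * X * derivative^[k + 1] ((X ^ 2 - 1) ^ l) +
      (k : ℝ[X]) * ((k : ℝ[X]) + 1) * derivative^[k] ((X ^ 2 - 1) ^ l) =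
    2 * (l : ℝ[X]) * X * derivative^[k + 1] ((X ^ 2 - 1) ^ l) +
      2 * (l : ℝ[X]) * ((k : ℝ[X]) + 1) * derivative^[k] ((X ^ 2 - 1) ^ l) := by
  induction k with
  | zero =>
    have h := congrArg derivative (rodrigues_base_derivative l)
    simp only [derivative_mul, derivative_sub, derivative_X_pow, derivative_one,
      derivative_natCast, derivative_X, derivative_ofNat, map_natCast] at h
    simp only [Function.iterate_succ, Function.iterate_zero, Function.comp, id]
    push_cast at h ⊢
    linear_combination h
  | succ k ih =>
    have h := congrArg derivative ih
    simp only [derivative_mul, derivative_add, derivative_sub, derivative_X_pow, derivative_one,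
      derivative_natCast, derivative_X, derivative_ofNat,
      ← Function.iterate_succ_apply' derivative, map_natCast] at h
    push_cast at h ⊢
    simp only [Nat.succ_eq_add_one, show k + 1 + 2 = k + 2 + 1 from rfl,
      show k + 1 + 1 = k + 2 from rfl] at h ⊢
    linear_combination h

/-- The differentiated Legendre equation. -/
theorem legendreP_ode (l j : ℕ) :
    (1 - X ^ 2 : ℝ[X]) * derivative^[j + 2] (legendreP l) =
      2 * ((j : ℝ[X]) + 1) * X * derivative^[j + 1] (legendreP l) -
        ((l : ℝ[X]) - (j : ℝ[X])) * ((l : ℝ[X]) + (j : ℝ[X]) + 1) *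
          derivative^[j] (legendreP l) := by
  have h := rodrigues_base_iterate_derivative l (l + j)
  unfold legendreP
  simp only [iterate_derivative_C_mul, ← Function.iterate_add_apply]
  have e2 : l + j + 2 = j + 2 + l := by ring
  have e1 : l + j + 1 = j + 1 + l := by ring
  rw [e2, e1, Nat.add_comm l j] at h
  push_cast at h
  linear_combination (-C (1 / (2 ^ l * (l.factorial : ℝ)))) * h

/-- The Sturm–Liouville form: the differentiated equation times `(1 - X²)^j` is an exact derivative.
The factor on the right is the one by which `wt l j` grows at each integration by parts. -/
theorem derivative_weight_mul_legendreP (l j : ℕ) :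
    derivative ((1 - X ^ 2 : ℝ[X]) ^ (j + 1) * derivative^[j + 1] (legendreP l)) =
      -(C (((l : ℝ) - j) * (l + j + 1))) *
        ((1 - X ^ 2) ^ j * derivative^[j] (legendreP l)) := by
  have h := legendreP_ode l j
  rw [derivative_mul, ← Function.iterate_succ_apply' derivative, derivative_pow]
  simp only [derivative_X_pow, derivative_one, Nat.add_sub_cancel, map_natCast,
    map_mul, map_sub, map_add, map_one, pow_succ (1 - X ^ 2 : ℝ[X]) j, Nat.succ_eq_add_one]
  push_cast
  rw [show j + 1 + 1 = j + 2 from rfl]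
  linear_combination (1 - X ^ 2 : ℝ[X]) ^ j * h

/-- The number `(l + j)! / (l - j)!`, zero for `l < j`. -/
noncomputable def wt (l j : ℕ) : ℝ := ∏ i ∈ Finset.range j, ((l : ℝ) - i) * (l + i + 1)

@[simp] theorem wt_zero (l : ℕ) : wt l 0 = 1 := by simp [wt]

theorem wt_succ (l j : ℕ) : wt l (j + 1) = wt l j * (((l : ℝ) - j) * (l + j + 1)) := by
  simp [wt, Finset.prod_range_succ]

theorem wt_eq_zero {l j : ℕ} (h : l < j) : wt l j = 0 := by
  unfold wt
  exact Finset.prod_eq_zero (Finset.mem_range.2 h) (by simp)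

theorem wt_pos {l j : ℕ} (h : j ≤ l) : 0 < wt l j := by
  unfold wt
  refine Finset.prod_pos fun i hi => ?_
  have : (i : ℝ) < l := by
    have := Finset.mem_range.1 hi
    exact_mod_cast (by omega : i < l)
  have h0 : (0 : ℝ) ≤ i := by positivity
  apply mul_pos <;> linarith

theorem wt_nonneg (l j : ℕ) : 0 ≤ wt l j := by
  rcases lt_or_ge l j with h | h
  · rw [wt_eq_zero h]
  · exact (wt_pos h).le

/-- Iterating the divergence form lowers `j` to `0`. It lets a weak derivative tested against the
weighted `P_l^{(j)}` return the Legendre coefficient of the function itself. -/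
theorem iterate_derivative_weight_mul_legendreP (l j : ℕ) :
    derivative^[j] ((1 - X ^ 2 : ℝ[X]) ^ j * derivative^[j] (legendreP l)) =
      C ((-1) ^ j * wt l j) * legendreP l := by
  induction j with
  | zero => simp
  | succ j ih =>
    rw [Function.iterate_succ_apply, derivative_weight_mul_legendreP, ← C_neg,
      iterate_derivative_C_mul, ih, wt_succ, ← mul_assoc, ← C_mul]
    congr 2
    ring

/-! ### Degree, endpoint values and the bound `|P_l| ≤ 1` -/

theorem natDegree_sq_sub_one_pow (l : ℕ) : ((X ^ 2 - 1 : ℝ[X]) ^ l).natDegree = l * 2 := by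
  have h : (X ^ 2 - 1 : ℝ[X]) = X ^ 2 - C 1 := by simp
  rw [h, natDegree_pow, natDegree_X_pow_sub_C]

theorem iterate_derivative_natDegree_le {p : ℝ[X]} {n : ℕ} (h : p.natDegree ≤ n) :
    derivative^[n] p = C (n.factorial * p.coeff n) := by
  ext m
  rw [coeff_iterate_derivative, coeff_C]
  split_ifs with hm
  · simp [hm, Nat.descFactorial_self]
  · rw [coeff_eq_zero_of_natDegree_lt (by omega)]; simp

theorem iterate_derivative_legendreP_self (l : ℕ) :
    derivative^[l] (legendreP l) = C (((2 * l).factorial : ℝ) / (2 ^ l * l.factorial)) := by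
  have hm : ((X ^ 2 - 1 : ℝ[X]) ^ l).Monic := by
    have h : (X ^ 2 - 1 : ℝ[X]) = X ^ 2 - C 1 := by simp
    rw [h]
    exact (monic_X_pow_sub_C 1 two_ne_zero).pow l
  have hd := natDegree_sq_sub_one_pow l
  have hc : ((X ^ 2 - 1 : ℝ[X]) ^ l).coeff (2 * l) = 1 := by
    have := hm.coeff_natDegree
    rwa [hd, mul_comm] at this
  unfold legendreP
  rw [iterate_derivative_C_mul, ← Function.iterate_add_apply, ← two_mul,
    iterate_derivative_natDegree_le (by rw [hd, mul_comm]), hc, ← C_mul]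
  congr 1
  ring

theorem natDegree_legendreP_le (l : ℕ) : (legendreP l).natDegree ≤ l := by
  unfold legendreP
  refine (natDegree_C_mul_le _ _).trans ((natDegree_iterate_derivative _ _).trans ?_)
  rw [natDegree_sq_sub_one_pow]
  omega

theorem degree_legendreP (l : ℕ) : (legendreP l).degree = l := by
  have h := iterate_derivative_natDegree_le (natDegree_legendreP_le l)
  rw [iterate_derivative_legendreP_self] at h
  have h2 := C_injective h
  have h3 : (legendreP l).coeff l ≠ 0 := by
    intro h0
    rw [h0, mul_zero] at h2
    have : (0 : ℝ) < ((2 * l).factorial : ℝ) / (2 ^ l * l.factorial) := by positivity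
    linarith
  have h4 := le_natDegree_of_ne_zero h3
  have h5 := natDegree_legendreP_le l
  have h6 : (legendreP l).natDegree = l := le_antisymm h5 h4
  rw [degree_eq_natDegree, h6]
  rintro h0
  simp [h0] at h3

theorem iterate_derivative_legendreP_of_lt {l j : ℕ} (h : l < j) :
    derivative^[j] (legendreP l) = 0 :=
  iterate_derivative_eq_zero ((natDegree_legendreP_le l).trans_lt h)

/-- At `c` only the Leibniz term in which all `l` derivatives fall on the power survives. Used at
both endpoints, where `X² - 1` has simple roots. -/
theorem eval_iterate_derivative_X_sub_C_pow_mul (c : ℝ) (l : ℕ) (q : ℝ[X]) :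
    (derivative^[l] ((X - C c) ^ l * q)).eval c = l.factorial * q.eval c := by
  induction l generalizing q with
  | zero => simp
  | succ l ih =>
    have h : derivative ((X - C c) ^ (l + 1) * q) =
        (X - C c) ^ l * (((l : ℝ[X]) + 1) * q + (X - C c) * derivative q) := by
      rw [derivative_mul, derivative_X_sub_C_pow, Nat.add_sub_cancel]
      simp only [map_natCast]
      push_cast
      ring
    rw [Function.iterate_succ_apply, h, ih, Nat.factorial_succ]
    simp
    ring

theorem legendreP_eval_one (l : ℕ) : (legendreP l).eval 1 = 1 := by
  have h : (X ^ 2 - 1 : ℝ[X]) ^ l = (X - C 1) ^ l * (X + 1) ^ l := by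
    rw [← mul_pow]; congr 1; simp; ring
  unfold legendreP
  rw [eval_C_mul, h, eval_iterate_derivative_X_sub_C_pow_mul]
  simp
  norm_num
  field_simp

theorem legendreP_eval_neg_one (l : ℕ) : (legendreP l).eval (-1) = (-1) ^ l := by
  have h : (X ^ 2 - 1 : ℝ[X]) ^ l = (X - C (-1)) ^ l * (X - 1) ^ l := by
    rw [← mul_pow]; congr 1; simp; ring
  unfold legendreP
  rw [eval_C_mul, h, eval_iterate_derivative_X_sub_C_pow_mul]
  simp
  rw [show (-1 - 1 : ℝ) = (-1) * 2 by norm_num, mul_pow]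
  field_simp

/-- For `l > 0`, with `k = l(l+1)`, the function `F = k P² + (1 - x²) P'²` has `F' = 2x P'²` by
Legendre's equation. So `F` increases away from `0` and is at most its endpoint value `k`; dropping
the nonnegative second term gives `P² ≤ 1`. -/
theorem abs_legendreP_eval_le_one (l : ℕ) {x : ℝ} (hx : x ∈ Icc (-1 : ℝ) 1) :
    |(legendreP l).eval x| ≤ 1 := by
  rcases Nat.eq_zero_or_pos l with rfl | hl
  · simp [legendreP]
  set P := legendreP l
  have hlr : (0 : ℝ) < l := by exact_mod_cast hl
  set k : ℝ := l * (l + 1) with hk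
  have hk0 : 0 < k := by positivity
  let F : ℝ[X] := C k * P ^ 2 + (1 - X ^ 2) * (derivative P) ^ 2
  have hF : derivative F = 2 * X * (derivative P) ^ 2 := by
    have h := legendreP_ode l 0
    simp only [Function.iterate_succ, Function.iterate_zero, Function.comp, id, zero_add] at h
    simp only [F, derivative_mul, derivative_pow, derivative_sub, derivative_one,
      derivative_X, hk, map_mul, map_add, map_natCast, map_one]
    simp at h ⊢
    linear_combination (2 * derivative P) * h
  have hd : ∀ y, deriv (fun y => F.eval y) y = 2 * y * ((derivative P).eval y) ^ 2 := by
    intro y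
    rw [Polynomial.deriv, hF]
    simp
  have hle : F.eval x ≤ k := by
    rcases le_total 0 x with h0 | h0
    · have hm : MonotoneOn (fun y => F.eval y) (Ici 0) := by
        apply monotoneOn_of_deriv_nonneg (convex_Ici 0) F.continuous.continuousOn
          F.differentiable.differentiableOn
        intro y hy
        rw [interior_Ici] at hy
        rw [hd]
        have : 0 < y := hy
        positivity
      have := hm (mem_Ici.2 h0) (mem_Ici.2 zero_le_one) hx.2
      refine this.trans ?_
      simp [F, P, legendreP_eval_one]
    · have hm : AntitoneOn (fun y => F.eval y) (Iic 0) := by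
        apply antitoneOn_of_deriv_nonpos (convex_Iic 0) F.continuous.continuousOn
          F.differentiable.differentiableOn
        intro y hy
        rw [interior_Iic] at hy
        rw [hd]
        have : y < 0 := hy
        have h2 : 0 ≤ ((derivative P).eval y) ^ 2 := sq_nonneg _
        nlinarith
      have := hm (mem_Iic.2 (by norm_num : (-1 : ℝ) ≤ 0)) (mem_Iic.2 h0) hx.1
      refine this.trans ?_
      simp [F, P, legendreP_eval_neg_one, ← pow_mul, mul_comm l 2]
  have hx2 : 0 ≤ 1 - x ^ 2 := by nlinarith [hx.1, hx.2]
  have h3 : F.eval x = k * (P.eval x) ^ 2 + (1 - x ^ 2) * ((derivative P).eval x) ^ 2 := by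
    simp [F]
  have h4 : 0 ≤ (1 - x ^ 2) * ((derivative P).eval x) ^ 2 := by positivity
  have h5 : k * (P.eval x) ^ 2 ≤ k * 1 := by linarith
  have h6 := le_of_mul_le_mul_left h5 hk0
  exact (sq_le_one_iff_abs_le_one _).1 h6

/-! ### Weighted orthogonality of the derivatives -/

theorem integrableOn_polynomial (p : ℝ[X]) :
    IntegrableOn (fun x => p.eval x) (Ioo (-1 : ℝ) 1) :=
  (p.continuous.integrableOn_Icc).mono_set Ioo_subset_Icc_self

theorem setIntegral_derivative (p : ℝ[X]) :
    ∫ x in Ioo (-1 : ℝ) 1, (derivative p).eval x = p.eval 1 - p.eval (-1) := by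
  rw [← integral_Ioc_eq_integral_Ioo, ← intervalIntegral.integral_of_le (by norm_num)]
  exact intervalIntegral.integral_eq_sub_of_hasDerivAt (fun x _ => p.hasDerivAt x)
    ((derivative p).continuous.intervalIntegrable _ _)

/-- One integration by parts per step, with the weight `(1 - x²)^(j+1)` removing the boundary terms.
-/
theorem setIntegral_weight_mul_legendreP (l m j : ℕ) :
    ∫ x in Ioo (-1 : ℝ) 1, ((1 - X ^ 2) ^ j * derivative^[j] (legendreP l) *
        derivative^[j] (legendreP m)).eval x =
      wt l j * ∫ x in Ioo (-1 : ℝ) 1, (legendreP l * legendreP m).eval x := by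
  induction j with
  | zero => simp
  | succ j ih =>
    have h := setIntegral_derivative ((1 - X ^ 2) ^ (j + 1) * derivative^[j + 1] (legendreP l) *
      derivative^[j] (legendreP m))
    rw [derivative_mul, derivative_weight_mul_legendreP,
      ← Function.iterate_succ_apply' derivative] at h
    simp only [eval_add] at h
    rw [integral_add (integrableOn_polynomial _) (integrableOn_polynomial _)] at h
    have e : ∀ x : ℝ, eval x (-C (((l : ℝ) - j) * (l + j + 1)) *
        ((1 - X ^ 2) ^ j * derivative^[j] (legendreP l)) * derivative^[j] (legendreP m)) =
        (-(((l : ℝ) - j) * (l + j + 1))) * eval x ((1 - X ^ 2) ^ j *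
          derivative^[j] (legendreP l) * derivative^[j] (legendreP m)) := by
      intro x
      simp only [eval_mul, eval_neg, eval_C]
      ring
    simp only [e] at h
    rw [integral_const_mul, ih] at h
    have h1 : eval (1 : ℝ) ((1 - X ^ 2) ^ (j + 1) * derivative^[j + 1] (legendreP l) *
      derivative^[j] (legendreP m)) = 0 := by simp [-Function.iterate_succ]
    have h2 : eval (-1 : ℝ) ((1 - X ^ 2) ^ (j + 1) * derivative^[j + 1] (legendreP l) *
      derivative^[j] (legendreP m)) = 0 := by simp [-Function.iterate_succ]
    rw [h1, h2] at h
    rw [wt_succ]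
    linear_combination h

/-- The weighted integral with `j = 1` is symmetric in `l` and `m`, while its factor `l(l+1)` is
not: the difference of the factors is `(l - m)(l + m + 1)`. -/
theorem setIntegral_legendreP_mul_of_ne {l m : ℕ} (h : l ≠ m) :
    ∫ x in Ioo (-1 : ℝ) 1, (legendreP l * legendreP m).eval x = 0 := by
  have h1 := setIntegral_weight_mul_legendreP l m 1
  have h2 := setIntegral_weight_mul_legendreP m l 1
  rw [mul_comm (legendreP m)] at h2
  rw [mul_right_comm, h1] at h2
  simp only [wt, Finset.range_one, Finset.prod_singleton] at h2
  have h3 : ((l : ℝ) - m) * (l + m + 1) *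
      ∫ x in Ioo (-1 : ℝ) 1, (legendreP l * legendreP m).eval x = 0 := by
    push_cast at h2
    linear_combination h2
  have h4 : ((l : ℝ) - m) ≠ 0 := sub_ne_zero.2 (by exact_mod_cast h)
  have h5 : ((l : ℝ) + m + 1) ≠ 0 := by positivity
  simpa [h4, h5] using h3

/-- Integrating the derivative of `x(1 - x²)^(l+1)`, which vanishes at both ends, gives the
recursion `(2l+3) I_{l+1} = 2(l+1) I_l`. -/
theorem setIntegral_one_sub_sq_pow (l : ℕ) :
    ∫ x in Ioo (-1 : ℝ) 1, ((1 - X ^ 2 : ℝ[X]) ^ l).eval x =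
      2 * (2 ^ l * l.factorial) ^ 2 / ((2 * l).factorial * (2 * l + 1)) := by
  induction l with
  | zero => simp; norm_num
  | succ l ih =>
    have h := setIntegral_derivative (X * (1 - X ^ 2) ^ (l + 1))
    have e : derivative (X * (1 - X ^ 2 : ℝ[X]) ^ (l + 1)) =
        C (2 * (l : ℝ) + 3) * (1 - X ^ 2) ^ (l + 1) + C (-(2 * ((l : ℝ) + 1))) * (1 - X ^ 2) ^ l := by
      rw [derivative_mul, derivative_pow]
      simp only [derivative_sub, derivative_X_pow, derivative_one, Nat.add_sub_cancel,
        map_natCast, map_mul, map_add, map_neg, derivative_X, map_one, map_ofNat]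
      push_cast
      ring
    rw [e] at h
    simp only [eval_add, eval_C_mul] at h
    rw [integral_add ((integrableOn_polynomial _).const_mul _)
      ((integrableOn_polynomial _).const_mul _), integral_const_mul, integral_const_mul, ih] at h
    have h0 : eval (1 : ℝ) (X * (1 - X ^ 2) ^ (l + 1)) -
      eval (-1 : ℝ) (X * (1 - X ^ 2) ^ (l + 1)) = 0 := by simp
    rw [h0] at h
    have h3 : (2 * (l : ℝ) + 3) ≠ 0 := by positivity
    have h4 : ((2 * l).factorial : ℝ) ≠ 0 := by positivity
    have h5 : (2 * (l : ℝ) + 1) ≠ 0 := by positivity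
    have h6 : ((2 * (l + 1)).factorial : ℝ) = (2 * l + 2) * (2 * l + 1) * (2 * l).factorial := by
      rw [show 2 * (l + 1) = 2 * l + 1 + 1 by ring, Nat.factorial_succ, Nat.factorial_succ]
      push_cast
      ring
    have h7 : (2 * (l : ℝ) + 2) ≠ 0 := by positivity
    rw [h6, Nat.factorial_succ]
    apply mul_left_cancel₀ h3
    push_cast
    rw [show (2 * ((l : ℝ) + 1) + 1) = 2 * l + 3 by ring]
    field_simp
    field_simp at h
    ring_nf at h ⊢
    linarith

theorem wt_mul_factorial {l j : ℕ} (h : j ≤ l) :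
    wt l j * (l - j).factorial = (l + j).factorial := by
  induction j with
  | zero => simp
  | succ j ih =>
    have ih := ih (by omega)
    obtain ⟨k, rfl⟩ := Nat.exists_eq_add_of_le h
    rw [show j + 1 + k - j = k + 1 by omega, Nat.factorial_succ] at ih
    rw [show j + 1 + k - (j + 1) = k by omega, wt_succ,
      show j + 1 + k + (j + 1) = (j + 1 + k + j) + 1 by ring, Nat.factorial_succ]
    push_cast at ih ⊢
    rw [← ih]
    ring

/-- Take `j = l` in the weighted identity: `P_l^{(l)}` is constant, so only the integral of `(1 -
x²)^l` remains. -/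
theorem setIntegral_legendreP_mul_self (l : ℕ) :
    ∫ x in Ioo (-1 : ℝ) 1, (legendreP l * legendreP l).eval x = 2 / (2 * l + 1) := by
  have h := setIntegral_weight_mul_legendreP l l l
  have hw := wt_mul_factorial (le_refl l)
  rw [Nat.sub_self, Nat.factorial_zero, Nat.cast_one, mul_one, ← two_mul] at hw
  simp only [iterate_derivative_legendreP_self, eval_mul, eval_C] at h
  rw [integral_mul_const, integral_mul_const, setIntegral_one_sub_sq_pow, hw] at h
  have h4 : ((2 * l).factorial : ℝ) ≠ 0 := by positivity
  apply mul_left_cancel₀ h4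
  simp only [eval_mul]
  rw [← h]
  field_simp

/-! ### The weighted orthonormal systems in `L²(-1, 1)` -/

theorem memLp_weightedPoly (j : ℕ) (p : ℝ[X]) :
    MemLp (fun x => √(1 - x ^ 2) ^ j * p.eval x) 2 volI := by
  have hc : Continuous (fun x : ℝ => √(1 - x ^ 2) ^ j * p.eval x) := by
    have := p.continuous
    fun_prop
  obtain ⟨M, hM⟩ := isCompact_Icc.exists_bound_of_continuousOn (s := Icc (-1 : ℝ) 1)
    hc.continuousOn
  refine MemLp.of_bound hc.aestronglyMeasurable M ?_
  filter_upwards [ae_restrict_mem measurableSet_Ioo] with x hx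
  exact hM x (Ioo_subset_Icc_self hx)

/-- A polynomial times `(1 - x²)^{j/2}`, as an element of `L²(-1, 1)`. -/
noncomputable def weightedPoly (j : ℕ) (p : ℝ[X]) : L2I := (memLp_weightedPoly j p).toLp _

theorem coeFn_weightedPoly (j : ℕ) (p : ℝ[X]) :
    weightedPoly j p =ᵐ[volI] fun x => √(1 - x ^ 2) ^ j * p.eval x :=
  (memLp_weightedPoly j p).coeFn_toLp

theorem inner_L2I (u v : L2I) : inner ℝ u v = ∫ x in Ioo (-1 : ℝ) 1, u x * v x := by
  rw [L2.inner_def]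
  refine integral_congr_ae (Eventually.of_forall fun x => ?_)
  simp [mul_comm]

theorem inner_weightedPoly_left (j : ℕ) (p : ℝ[X]) (u : L2I) :
    inner ℝ (weightedPoly j p) u = ∫ x in Ioo (-1 : ℝ) 1, √(1 - x ^ 2) ^ j * p.eval x * u x := by
  rw [inner_L2I]
  refine integral_congr_ae ?_
  filter_upwards [coeFn_weightedPoly j p] with x hx
  rw [hx]

theorem inner_weightedPoly (j : ℕ) (p q : ℝ[X]) :
    inner ℝ (weightedPoly j p) (weightedPoly j q) =
      ∫ x in Ioo (-1 : ℝ) 1, ((1 - X ^ 2) ^ j * p * q).eval x := by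
  rw [inner_weightedPoly_left]
  refine integral_congr_ae ?_
  filter_upwards [coeFn_weightedPoly j q, ae_restrict_mem measurableSet_Ioo] with x hx hI
  have h0 : 0 ≤ 1 - x ^ 2 := by nlinarith [hI.1, hI.2]
  rw [hx]
  have : √(1 - x ^ 2) ^ j * √(1 - x ^ 2) ^ j = (1 - x ^ 2) ^ j := by
    rw [← mul_pow, Real.mul_self_sqrt h0]
  simp only [eval_mul, eval_pow, eval_sub, eval_one, eval_X]
  rw [← this]
  ring

theorem legendreCoeff_eq_inner (u : L2I) (l : ℕ) :
    legendreCoeff u l = inner ℝ (weightedPoly 0 (legendreP l)) u := by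
  rw [inner_weightedPoly_left, legendreCoeff]
  simp [mul_comm]

/-- The scaling factor that normalizes `(1 - x²)^{j/2} P_l^{(j)}` in `L²(-1, 1)`. -/
noncomputable def normFactor (j l : ℕ) : ℝ := √((2 * (l : ℝ) + 1) / 2 / wt l j)

/-- The normalized functions `(1 - x²)^{j/2} P_l^{(j)}`, `l = i + j`. -/
noncomputable def weightedLegendre (j i : ℕ) : L2I :=
  normFactor j (i + j) • weightedPoly j (derivative^[j] (legendreP (i + j)))

theorem orthonormal_weightedLegendre (j : ℕ) : Orthonormal ℝ (weightedLegendre j) := by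
  rw [orthonormal_iff_ite]
  intro i k
  unfold weightedLegendre
  rw [real_inner_smul_left, real_inner_smul_right, inner_weightedPoly,
    setIntegral_weight_mul_legendreP]
  split_ifs with h
  · subst h
    rw [setIntegral_legendreP_mul_self, ← mul_assoc, normFactor,
      Real.mul_self_sqrt (div_nonneg (by positivity) (wt_nonneg _ _))]
    have := (wt_pos (Nat.le_add_left j i)).ne'
    field_simp
  · rw [setIntegral_legendreP_mul_of_ne (by omega)]
    simp

/-! ### Completeness and the Legendre basis -/

theorem ae_eq_zero_of_forall_polynomial {f : ℝ → ℝ} (hf : IntegrableOn f (Ioo (-1 : ℝ) 1))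
    (h : ∀ p : ℝ[X], ∫ x in Ioo (-1 : ℝ) 1, p.eval x * f x = 0) :
    ∀ᵐ x ∂volI, f x = 0 := by
  rw [ae_restrict_iff' measurableSet_Ioo]
  refine isOpen_Ioo.ae_eq_zero_of_integral_contDiff_smul_eq_zero hf.locallyIntegrableOn ?_
  intro g hg _ hs
  have h0 : ∫ x, g x • f x = ∫ x in Ioo (-1 : ℝ) 1, g x * f x := by
    refine (setIntegral_eq_integral_of_forall_compl_eq_zero fun x hx => ?_).symm
    rw [image_eq_zero_of_notMem_tsupport fun hx' => hx (hs hx'), zero_smul]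
  rw [h0]
  have hint : ∀ k : ℝ → ℝ, Continuous k → IntegrableOn (fun x => k x * f x) (Ioo (-1 : ℝ) 1) := by
    intro k hk
    obtain ⟨M, hM⟩ := isCompact_Icc.exists_bound_of_continuousOn (s := Icc (-1 : ℝ) 1)
      hk.continuousOn
    refine Integrable.bdd_mul (c := M) hf hk.aestronglyMeasurable ?_
    filter_upwards [ae_restrict_mem measurableSet_Ioo] with x hx
    exact hM x (Ioo_subset_Icc_self hx)
  refine abs_eq_zero.1 (le_antisymm (le_of_forall_pos_le_add fun ε hε => ?_) (abs_nonneg _))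
  set I := ∫ x in Ioo (-1 : ℝ) 1, |f x| with hI
  have hI0 : 0 ≤ I := integral_nonneg fun x => abs_nonneg _
  -- Weierstrass approximation; the `+ 1` keeps the tolerance meaningful when the `L¹` norm `I` is
  -- zero.
  obtain ⟨p, hp⟩ := exists_polynomial_near_of_continuousOn (-1) 1 g hg.continuous.continuousOn
    (ε / (I + 1)) (by positivity)
  have e : ∫ x in Ioo (-1 : ℝ) 1, g x * f x =
      -∫ x in Ioo (-1 : ℝ) 1, (p.eval x - g x) * f x := by
    have : ∀ x, (p.eval x - g x) * f x = p.eval x * f x - g x * f x := fun x => by ring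
    simp only [this]
    rw [integral_sub (hint _ p.continuous) (hint _ hg.continuous), h p]
    ring
  rw [e, abs_neg, zero_add]
  calc |∫ x in Ioo (-1 : ℝ) 1, (p.eval x - g x) * f x|
      ≤ ∫ x in Ioo (-1 : ℝ) 1, ε / (I + 1) * |f x| := by
        rw [← Real.norm_eq_abs]
        refine norm_integral_le_of_norm_le (hf.abs.const_mul (ε / (I + 1))) ?_
        filter_upwards [ae_restrict_mem measurableSet_Ioo] with x hx
        rw [Real.norm_eq_abs, abs_mul]
        exact mul_le_mul_of_nonneg_right (hp x (Ioo_subset_Icc_self hx)).le (abs_nonneg _)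
    _ = ε / (I + 1) * I := by rw [integral_const_mul]
    _ ≤ ε := by
        rw [div_mul_eq_mul_div, div_le_iff₀ (by positivity)]
        nlinarith

theorem integrableOn_L2I (u : L2I) : IntegrableOn u (Ioo (-1 : ℝ) 1) :=
  (Lp.memLp u).integrable (by norm_num)

/-- As `P_l` has degree exactly `l`, the Legendre polynomials span all polynomials, so `u` is
orthogonal to every polynomial. -/
theorem eq_zero_of_legendreCoeff_eq_zero {u : L2I} (h : ∀ l, legendreCoeff u l = 0) : u = 0 := by
  have hint : ∀ p : ℝ[X], Integrable (fun x => p.eval x * u x) volI := by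
    intro p
    have := MemLp.integrable_mul (memLp_weightedPoly 0 p) (Lp.memLp u)
    simpa [Pi.mul_def] using this
  let φ : ℝ[X] →ₗ[ℝ] ℝ :=
    { toFun := fun p => ∫ x in Ioo (-1 : ℝ) 1, p.eval x * u x
      map_add' := fun p q => by
        simp only [eval_add, add_mul]
        exact integral_add (hint p) (hint q)
      map_smul' := fun c p => by
        simp only [eval_smul, smul_eq_mul, mul_assoc, RingHom.id_apply]
        rw [integral_const_mul] }
  let S : Polynomial.Sequence ℝ := ⟨legendreP, degree_legendreP⟩
  have hsp := S.span fun i => (isUnit_iff_ne_zero.2 (leadingCoeff_ne_zero.2 (S.ne_zero i)))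
  have hφ : φ = 0 := by
    refine LinearMap.ext_on_range hsp fun l => ?_
    have := h l
    rw [legendreCoeff] at this
    simp only [φ, LinearMap.coe_mk, AddHom.coe_mk, LinearMap.zero_apply]
    rw [← this]
    refine integral_congr_ae (Eventually.of_forall fun x => mul_comm _ _)
  have := ae_eq_zero_of_forall_polynomial (integrableOn_L2I u) fun p => congrArg (· p) hφ
  exact (Lp.eq_zero_iff_ae_eq_zero).2 this

theorem inner_weightedLegendre_zero (u : L2I) (l : ℕ) :
    inner ℝ (weightedLegendre 0 l) u = √((2 * (l : ℝ) + 1) / 2) * legendreCoeff u l := by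
  rw [legendreCoeff_eq_inner, weightedLegendre, real_inner_smul_left, normFactor]
  simp

/-- The Hilbert basis of normalized Legendre polynomials. -/
noncomputable def legendreBasis : HilbertBasis ℕ ℝ L2I :=
  HilbertBasis.mkOfOrthogonalEqBot (orthonormal_weightedLegendre 0) <| by
    rw [Submodule.eq_bot_iff]
    intro u hu
    refine eq_zero_of_legendreCoeff_eq_zero fun l => ?_
    have h1 := hu (weightedLegendre 0 l) (Submodule.subset_span ⟨l, rfl⟩)
    rw [inner_weightedLegendre_zero] at h1
    have : √((2 * (l : ℝ) + 1) / 2) ≠ 0 := by positivity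
    exact (mul_eq_zero.1 h1).resolve_left this

theorem legendreBasis_apply (l : ℕ) : legendreBasis l = weightedLegendre 0 l := by
  simp [legendreBasis]

theorem legendreBasis_repr (u : L2I) (l : ℕ) :
    legendreBasis.repr u l = √((2 * (l : ℝ) + 1) / 2) * legendreCoeff u l := by
  rw [HilbertBasis.repr_apply_apply, legendreBasis_apply, inner_weightedLegendre_zero]

/-- The squared coefficient of `u` with respect to the normalized Legendre polynomials. -/
noncomputable def sqCoeff (u : L2I) (l : ℕ) : ℝ := legendreCoeff u l ^ 2 * ((2 * (l : ℝ) + 1) / 2)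

theorem sqCoeff_nonneg (u : L2I) (l : ℕ) : 0 ≤ sqCoeff u l := by unfold sqCoeff; positivity

theorem sqCoeff_eq_repr_sq (u : L2I) (l : ℕ) : sqCoeff u l = legendreBasis.repr u l ^ 2 := by
  rw [legendreBasis_repr, mul_pow, Real.sq_sqrt (by positivity), sqCoeff, mul_comm]

theorem summable_sqCoeff (u : L2I) : Summable (sqCoeff u) := by
  have := legendreBasis.summable_inner_mul_inner u u
  refine this.congr fun l => ?_
  rw [sqCoeff_eq_repr_sq, HilbertBasis.repr_apply_apply, real_inner_comm, sq]

/-! ### Test functions and weak derivatives -/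

theorem contDiff_polynomial (p : ℝ[X]) : ContDiff ℝ (⊤ : ℕ∞) fun x => p.eval x := by
  simpa using p.contDiff_aeval (𝕜 := ℝ) (⊤ : ℕ∞)

theorem iteratedDeriv_polynomial (j : ℕ) (p : ℝ[X]) :
    iteratedDeriv j (fun x => p.eval x) = fun x => (derivative^[j] p).eval x := by
  induction j generalizing p with
  | zero => simp
  | succ j ih =>
    have : deriv (fun x => p.eval x) = fun x => (derivative p).eval x := by
      ext x; exact p.deriv
    rw [iteratedDeriv_succ', this, ih, Function.iterate_succ_apply]

/-- Smooth functions with compact support in `(-1, 1)`. -/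
structure IsTestFun (φ : ℝ → ℝ) : Prop where
  contDiff : ContDiff ℝ (⊤ : ℕ∞) φ
  hasCompactSupport : HasCompactSupport φ
  tsupport_subset : tsupport φ ⊆ Ioo (-1 : ℝ) 1

theorem IsTestFun.deriv {φ : ℝ → ℝ} (h : IsTestFun φ) : IsTestFun (deriv φ) :=
  ⟨(contDiff_infty_iff_deriv.1 h.contDiff).2, h.hasCompactSupport.deriv,
    fun _ hx => h.tsupport_subset (tsupport_deriv_subset hx)⟩

theorem IsTestFun.iteratedDeriv {φ : ℝ → ℝ} (h : IsTestFun φ) (j : ℕ) :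
    IsTestFun (iteratedDeriv j φ) := by
  induction j with
  | zero => simpa using h
  | succ j ih => rw [iteratedDeriv_succ]; exact ih.deriv

theorem IsTestFun.setIntegral_mul {φ : ℝ → ℝ} (h : IsTestFun φ) (f : ℝ → ℝ) :
    ∫ x in Ioo (-1 : ℝ) 1, f x * φ x = ∫ x, f x * φ x := by
  refine setIntegral_eq_integral_of_forall_compl_eq_zero fun x hx => ?_
  rw [image_eq_zero_of_notMem_tsupport fun hx' => hx (h.tsupport_subset hx'), mul_zero]

theorem IsTestFun.integrable_mul {φ f : ℝ → ℝ} (h : IsTestFun φ) (hf : Continuous f) :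
    Integrable (fun x => f x * φ x) :=
  (hf.mul h.contDiff.continuous).integrable_of_hasCompactSupport h.hasCompactSupport.mul_left

theorem IsTestFun.exists_bound {φ : ℝ → ℝ} (h : IsTestFun φ) : ∃ C, ∀ x, ‖φ x‖ ≤ C :=
  h.hasCompactSupport.exists_bound_of_continuous h.contDiff.continuous

theorem IsTestFun.setIntegral_polynomial_mul_deriv {φ : ℝ → ℝ} (h : IsTestFun φ) (p : ℝ[X]) :
    ∫ x in Ioo (-1 : ℝ) 1, p.eval x * _root_.deriv φ x =
      -∫ x in Ioo (-1 : ℝ) 1, (derivative p).eval x * φ x := by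
  rw [h.deriv.setIntegral_mul, h.setIntegral_mul]
  exact integral_mul_deriv_eq_deriv_mul_of_integrable (fun x _ => p.hasDerivAt x)
    (fun x _ => ((h.contDiff.differentiable (by simp)) x).hasDerivAt)
    (h.deriv.integrable_mul p.continuous) (h.integrable_mul (derivative p).continuous)
    (h.integrable_mul p.continuous)

theorem IsTestFun.setIntegral_polynomial_mul_iteratedDeriv {φ : ℝ → ℝ} (h : IsTestFun φ)
    (j : ℕ) (p : ℝ[X]) :
    ∫ x in Ioo (-1 : ℝ) 1, p.eval x * _root_.iteratedDeriv j φ x =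
      (-1) ^ j * ∫ x in Ioo (-1 : ℝ) 1, (derivative^[j] p).eval x * φ x := by
  induction j generalizing φ with
  | zero => simp
  | succ j ih =>
    rw [iteratedDeriv_succ', ih h.deriv, h.setIntegral_polynomial_mul_deriv,
      Function.iterate_succ_apply', pow_succ]
    ring

theorem HasWeakDeriv.congr {j : ℕ} {u v g h : ℝ → ℝ} (H : HasWeakDeriv j u g)
    (huv : u =ᵐ[volI] v) (hgh : g =ᵐ[volI] h) : HasWeakDeriv j v h := by
  refine ⟨H.1.congr huv, H.2.1.congr hgh, fun φ h1 h2 h3 => ?_⟩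
  have e1 : ∫ x in Ioo (-1 : ℝ) 1, u x * iteratedDeriv j φ x =
      ∫ x in Ioo (-1 : ℝ) 1, v x * iteratedDeriv j φ x :=
    integral_congr_ae (huv.mono fun x hx => by simp only [hx])
  have e2 : ∫ x in Ioo (-1 : ℝ) 1, g x * φ x = ∫ x in Ioo (-1 : ℝ) 1, h x * φ x :=
    integral_congr_ae (hgh.mono fun x hx => by simp only [hx])
  rw [← e1, ← e2]
  exact H.2.2 φ h1 h2 h3

theorem hasWeakDeriv_polynomial (j : ℕ) (p : ℝ[X]) :
    HasWeakDeriv j (fun x => p.eval x) (fun x => (derivative^[j] p).eval x) :=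
  ⟨(integrableOn_polynomial _).locallyIntegrableOn, (integrableOn_polynomial _).locallyIntegrableOn,
    fun _ h1 h2 h3 => IsTestFun.setIntegral_polynomial_mul_iteratedDeriv ⟨h1, h2, h3⟩ j p⟩

/-! ### Cutoffs and integration by parts up to the boundary -/

/-- Uniform bound for derivatives of `x ↦ G (N (1 - x²)) p(x)`. -/
theorem exists_bound_iteratedDeriv_comp_weight (k : ℕ) (p : ℝ[X]) :
    ∃ C : ℝ, 0 ≤ C ∧ ∀ (G : ℝ → ℝ) (N M : ℝ), ContDiff ℝ (⊤ : ℕ∞) G →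
      (∀ i ≤ k, ∀ t ∈ Icc 0 N, |N ^ i * iteratedDeriv i G t| ≤ M) → 0 ≤ N →
      ∀ x ∈ Icc (-1 : ℝ) 1,
        |iteratedDeriv k (fun x => G (N * (1 - x ^ 2)) * p.eval x) x| ≤ C * M := by
  have mem : ∀ N : ℝ, 0 ≤ N → ∀ x ∈ Icc (-1 : ℝ) 1, N * (1 - x ^ 2) ∈ Icc 0 N := by
    intro N hN x hx
    have h1 : 0 ≤ 1 - x ^ 2 := by nlinarith [hx.1, hx.2]
    exact ⟨by positivity, by nlinarith [sq_nonneg x]⟩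
  induction k generalizing p with
  | zero =>
    obtain ⟨C, hC⟩ := isCompact_Icc.exists_bound_of_continuousOn (s := Icc (-1 : ℝ) 1)
      p.continuous.continuousOn
    refine ⟨C, (norm_nonneg _).trans (hC 0 (by norm_num)), fun G N M _ h hN x hx => ?_⟩
    have h1 := h 0 le_rfl _ (mem N hN x hx)
    simp only [pow_zero, one_mul, iteratedDeriv_zero] at h1
    rw [iteratedDeriv_zero, abs_mul, mul_comm]
    exact mul_le_mul (hC x hx) h1 (abs_nonneg _) ((norm_nonneg _).trans (hC x hx))
  | succ k ih =>
    -- The derivative has two terms of the same shape, one with `(N G', -2Xp)` and one with `(G,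
    -- p')`. The constant depends on the polynomial only, since `G` and `N` are quantified after it.
    obtain ⟨C1, h1, H1⟩ := ih (-2 * X * p)
    obtain ⟨C2, h2, H2⟩ := ih (derivative p)
    refine ⟨C1 + C2, by positivity, fun G N M hG h hN x hx => ?_⟩
    have hG' := (contDiff_infty_iff_deriv.1 hG).2
    have e : deriv (fun x => G (N * (1 - x ^ 2)) * p.eval x) =
        (fun x => (N * deriv G (N * (1 - x ^ 2))) * (-2 * X * p).eval x) +
          fun x => G (N * (1 - x ^ 2)) * (derivative p).eval x := by
      ext y
      have hd1 : HasDerivAt (fun x : ℝ => N * (1 - x ^ 2)) (N * (-(2 * y))) y := by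
        have := ((hasDerivAt_pow 2 y).const_sub 1).const_mul N
        simpa using this
      have hd2 := ((hG.differentiable (by simp)) (N * (1 - y ^ 2))).hasDerivAt
      have hd3 := (hd2.comp y hd1).mul (p.hasDerivAt y)
      have := hd3.deriv
      simp only [Pi.add_apply]
      refine Eq.trans this ?_
      simp
      ring
    have c1 : ContDiff ℝ (⊤ : ℕ∞) fun x : ℝ =>
        (N * deriv G (N * (1 - x ^ 2))) * (-2 * X * p).eval x := by
      have := contDiff_polynomial (-2 * X * p)
      fun_prop
    have c2 : ContDiff ℝ (⊤ : ℕ∞) fun x : ℝ => G (N * (1 - x ^ 2)) * (derivative p).eval x := by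
      have := contDiff_polynomial (derivative p)
      fun_prop
    rw [iteratedDeriv_succ', e, iteratedDeriv_add (c1.of_le (by exact_mod_cast le_top)).contDiffAt
      (c2.of_le (by exact_mod_cast le_top)).contDiffAt, add_mul]
    refine (abs_add_le _ _).trans (add_le_add ?_ ?_)
    · refine H1 (fun t => N * deriv G t) N M (by fun_prop) (fun i _ t ht => ?_) hN x hx
      have := h (i + 1) (by omega) t ht
      rw [iteratedDeriv_succ', pow_succ] at this
      rw [iteratedDeriv_const_mul_field, ← mul_assoc]
      exact this
    · exact H2 G N M hG (fun i _ t ht => h i (by omega) t ht) hN x hx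

/-- Beyond `t = 2` the function is exactly `t^j`; on `[0, 2]` compactness suffices. The subtraction
in the exponent truncates: for `i > j` the bound is constant. -/
theorem exists_bound_iteratedDeriv_pow_mul_smoothTransition (j i : ℕ) :
    ∃ C : ℝ, 0 ≤ C ∧ ∀ t : ℝ, 0 ≤ t →
      |iteratedDeriv i (fun t => t ^ j * Real.smoothTransition (t - 1)) t| ≤
        C * (1 + t) ^ (j - i) := by
  set G : ℝ → ℝ := fun t => t ^ j * Real.smoothTransition (t - 1) with hG
  have hs : ContDiff ℝ (⊤ : ℕ∞) G := by
    have := Real.smoothTransition.contDiff (n := ⊤)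
    fun_prop
  obtain ⟨C, hC⟩ := isCompact_Icc.exists_bound_of_continuousOn (s := Icc (0 : ℝ) 2)
    (hs.continuous_iteratedDeriv i (by exact_mod_cast le_top)).continuousOn
  have hC0 : 0 ≤ C := (norm_nonneg _).trans (hC 0 (by norm_num))
  refine ⟨C + j.descFactorial i, by positivity, fun t ht => ?_⟩
  have h1 : (1 : ℝ) ≤ (1 + t) ^ (j - i) := one_le_pow₀ (by linarith)
  rcases le_or_gt t 2 with h | h
  · have := hC t ⟨ht, h⟩
    rw [Real.norm_eq_abs] at this
    have h0 : (0 : ℝ) ≤ j.descFactorial i := by positivity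
    nlinarith
  · have e : G =ᶠ[𝓝 t] fun t => t ^ j := by
      filter_upwards [lt_mem_nhds h] with s hs
      simp only [hG]
      rw [Real.smoothTransition.one_of_one_le (by linarith), mul_one]
    rw [e.iteratedDeriv_eq, iteratedDeriv_pow, abs_of_nonneg (by positivity)]
    have h3 : t ^ (j - i) ≤ (1 + t) ^ (j - i) := pow_le_pow_left₀ ht (by linarith) _
    have h4 : (0 : ℝ) ≤ j.descFactorial i := by positivity
    have h5 : 0 ≤ C * (1 + t) ^ (j - i) := by positivity
    nlinarith [mul_le_mul_of_nonneg_left h3 h4]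

/-- Test functions approximating `(1 - x²)^j p(x)` from inside the interval. -/
noncomputable def cutoff (j : ℕ) (p : ℝ[X]) (m : ℕ) (x : ℝ) : ℝ :=
  (1 - x ^ 2) ^ j * Real.smoothTransition (((m : ℝ) + 1) * (1 - x ^ 2) - 1) * p.eval x

theorem isTestFun_cutoff (j : ℕ) (p : ℝ[X]) (m : ℕ) : IsTestFun (cutoff j p m) := by
  have hsub : tsupport (cutoff j p m) ⊆ {x | 1 ≤ ((m : ℝ) + 1) * (1 - x ^ 2)} := by
    refine closure_minimal ?_ (isClosed_le (by fun_prop) (by fun_prop))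
    intro x hx
    by_contra hn
    refine hx ?_
    simp only [mem_ofPred_eq, not_le] at hn
    rw [cutoff, Real.smoothTransition.zero_of_nonpos (by linarith)]
    simp
  have hI : {x : ℝ | 1 ≤ ((m : ℝ) + 1) * (1 - x ^ 2)} ⊆ Ioo (-1 : ℝ) 1 := by
    intro x hx
    have hm : (0 : ℝ) < (m : ℝ) + 1 := by positivity
    have h1 : 0 < 1 - x ^ 2 := by
      by_contra hn
      have : ((m : ℝ) + 1) * (1 - x ^ 2) ≤ 0 := mul_nonpos_of_nonneg_of_nonpos hm.le (by linarith)
      have hx : 1 ≤ ((m : ℝ) + 1) * (1 - x ^ 2) := hx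
      linarith
    constructor <;> nlinarith
  refine ⟨?_, ?_, hsub.trans hI⟩
  · have := Real.smoothTransition.contDiff (n := ⊤)
    have := contDiff_polynomial p
    unfold cutoff
    fun_prop
  · exact (isCompact_Icc (a := (-1 : ℝ)) (b := 1)).of_isClosed_subset isClosed_closure
      ((hsub.trans hI).trans Ioo_subset_Icc_self)

/-- Agreement holds near `x`, not just at `x`, so that all derivatives agree as well. -/
theorem eventually_cutoff_eq (j : ℕ) (p : ℝ[X]) {x : ℝ} (hx : x ∈ Ioo (-1 : ℝ) 1) :
    ∀ᶠ m : ℕ in atTop, cutoff j p m =ᶠ[𝓝 x] fun x => ((1 - X ^ 2) ^ j * p).eval x := by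
  have h1 : 0 < 1 - x ^ 2 := by nlinarith [hx.1, hx.2]
  obtain ⟨m0, hm0⟩ := exists_nat_gt (2 / (1 - x ^ 2))
  filter_upwards [eventually_ge_atTop m0] with m hm
  have hmr : (m0 : ℝ) ≤ m := by exact_mod_cast hm
  have h2 : 2 < ((m : ℝ) + 1) * (1 - x ^ 2) := by
    rw [div_lt_iff₀ h1] at hm0
    nlinarith
  have : ∀ᶠ y in 𝓝 x, 2 < ((m : ℝ) + 1) * (1 - y ^ 2) :=
    (isOpen_lt continuous_const (by fun_prop)).mem_nhds h2
  filter_upwards [this] with y hy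
  rw [cutoff, Real.smoothTransition.one_of_one_le (by linarith)]
  simp

theorem abs_cutoff_le (j : ℕ) (p : ℝ[X]) (m : ℕ) (x : ℝ) :
    |cutoff j p m x| ≤ |((1 - X ^ 2) ^ j * p).eval x| := by
  have h0 := Real.smoothTransition.nonneg (((m : ℝ) + 1) * (1 - x ^ 2) - 1)
  have h1 := Real.smoothTransition.le_one (((m : ℝ) + 1) * (1 - x ^ 2) - 1)
  simp only [cutoff, eval_mul, eval_pow, eval_sub, eval_one, eval_X, abs_mul, abs_of_nonneg h0]
  refine mul_le_mul_of_nonneg_right ?_ (abs_nonneg _)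
  exact mul_le_of_le_one_right (abs_nonneg _) h1

/-- By scaling, with `N = m + 1` the cutoff is `N^{-j} G(N(1 - x²)) p(x)`, where `G(t) = t^j` times
a transition. An `i`-th derivative of `G` brings `N^i` and has size `N^{j-i}`, which `N^{-j}`
cancels exactly: the weight pays for `j` derivatives of a layer of width `1/N`. -/
theorem exists_bound_iteratedDeriv_cutoff (j : ℕ) (p : ℝ[X]) :
    ∃ C : ℝ, ∀ (m : ℕ), ∀ x ∈ Ioo (-1 : ℝ) 1, |iteratedDeriv j (cutoff j p m) x| ≤ C := by
  choose D hD0 hD using exists_bound_iteratedDeriv_pow_mul_smoothTransition j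
  obtain ⟨C, hC0, hC⟩ := exists_bound_iteratedDeriv_comp_weight j p
  set M := ∑ i ∈ Finset.range (j + 1), D i * 2 ^ j with hM
  refine ⟨C * M, fun m x hx => ?_⟩
  set N : ℝ := (m : ℝ) + 1 with hN
  have hN1 : 1 ≤ N := by simp [hN]
  have hN0 : 0 < N := by linarith
  have e : cutoff j p m = fun x => (fun t : ℝ => (N ^ j)⁻¹ *
      (t ^ j * Real.smoothTransition (t - 1))) (N * (1 - x ^ 2)) * p.eval x := by
    ext y
    simp only [cutoff, ← hN]
    rw [mul_pow]
    field_simp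
  rw [e]
  refine hC (fun t : ℝ => (N ^ j)⁻¹ * (t ^ j * Real.smoothTransition (t - 1))) N M ?_ ?_ hN0.le x (Ioo_subset_Icc_self hx)
  · have := Real.smoothTransition.contDiff (n := ⊤)
    fun_prop
  · intro i hi t ht
    rw [iteratedDeriv_const_mul_field]
    have h1 := hD i t ht.1
    have hDi := hD0 i
    have h2 : (1 + t) ^ (j - i) ≤ (2 * N) ^ (j - i) :=
      pow_le_pow_left₀ (by linarith [ht.1]) (by linarith [ht.2]) _
    rw [mul_pow] at h2
    have h3 : (2 : ℝ) ^ (j - i) ≤ 2 ^ j := pow_le_pow_right₀ (by norm_num) (by omega)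
    have h4 : N ^ j = N ^ i * N ^ (j - i) := by rw [← pow_add]; congr 1; omega
    have h5 : 0 < N ^ (j - i) := by positivity
    rw [abs_mul, abs_mul, abs_of_pos (by positivity : 0 < N ^ i),
      abs_of_pos (by positivity : 0 < (N ^ j)⁻¹)]
    calc _ ≤ N ^ i * ((N ^ j)⁻¹ * (D i * (2 ^ j * N ^ (j - i)))) := by
          gcongr
          refine h1.trans ?_
          gcongr
          exact h2.trans (by gcongr)
      _ = D i * 2 ^ j := by
          rw [h4]
          field_simp
      _ ≤ M := by
          rw [hM]
          refine Finset.single_le_sum (f := fun i => D i * 2 ^ j) (fun k _ => ?_)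
            (Finset.mem_range.2 (by omega))
          have := hD0 k
          positivity

theorem HasWeakDeriv.aestronglyMeasurable {j : ℕ} {u g : ℝ → ℝ} (h : HasWeakDeriv j u g) :
    AEStronglyMeasurable g volI :=
  h.2.1.aestronglyMeasurable

theorem one_sub_sq_pos {x : ℝ} (hx : x ∈ Ioo (-1 : ℝ) 1) : 0 < 1 - x ^ 2 := by
  nlinarith [hx.1, hx.2]

/-- Integration by parts of a weak derivative against `(1 - x²)^j p`, without boundary terms. -/
theorem HasWeakDeriv.setIntegral_mul_weight {j : ℕ} {u g : ℝ → ℝ} (H : HasWeakDeriv j u g)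
    (hu : IntegrableOn u (Ioo (-1 : ℝ) 1)) (p : ℝ[X])
    (hg : IntegrableOn (fun x => g x * ((1 - X ^ 2) ^ j * p).eval x) (Ioo (-1 : ℝ) 1)) :
    ∫ x in Ioo (-1 : ℝ) 1, u x * (derivative^[j] ((1 - X ^ 2) ^ j * p)).eval x =
      (-1) ^ j * ∫ x in Ioo (-1 : ℝ) 1, g x * ((1 - X ^ 2) ^ j * p).eval x := by
  obtain ⟨C, hC⟩ := exists_bound_iteratedDeriv_cutoff j p
  -- Dominated convergence on both sides: here the uniform derivative bound gives the majorant `|u|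
  -- * C`; in `T2` the cutoffs are dominated by their limit.
  have T1 : Tendsto (fun m => ∫ x in Ioo (-1 : ℝ) 1, u x * iteratedDeriv j (cutoff j p m) x)
      atTop (𝓝 (∫ x in Ioo (-1 : ℝ) 1,
        u x * (derivative^[j] ((1 - X ^ 2) ^ j * p)).eval x)) := by
    refine tendsto_integral_of_dominated_convergence (fun x => |u x| * C) ?_ (hu.abs.mul_const C)
      ?_ ?_
    · intro m
      exact hu.aestronglyMeasurable.mul
        ((isTestFun_cutoff j p m).iteratedDeriv j).contDiff.continuous.aestronglyMeasurable
    · intro m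
      filter_upwards [ae_restrict_mem measurableSet_Ioo] with x hx
      rw [Real.norm_eq_abs, abs_mul]
      exact mul_le_mul_of_nonneg_left (hC m x hx) (abs_nonneg _)
    · filter_upwards [ae_restrict_mem measurableSet_Ioo] with x hx
      refine tendsto_const_nhds.congr' ?_
      filter_upwards [eventually_cutoff_eq j p hx] with m hm
      rw [hm.iteratedDeriv_eq, iteratedDeriv_polynomial]
  have T2 : Tendsto (fun m => ∫ x in Ioo (-1 : ℝ) 1, g x * cutoff j p m x)
      atTop (𝓝 (∫ x in Ioo (-1 : ℝ) 1, g x * ((1 - X ^ 2) ^ j * p).eval x)) := by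
    refine tendsto_integral_of_dominated_convergence _ ?_ hg.norm ?_ ?_
    · intro m
      exact H.aestronglyMeasurable.mul
        (isTestFun_cutoff j p m).contDiff.continuous.aestronglyMeasurable
    · intro m
      refine Eventually.of_forall fun x => ?_
      rw [Real.norm_eq_abs, Real.norm_eq_abs, abs_mul, abs_mul]
      exact mul_le_mul_of_nonneg_left (abs_cutoff_le j p m x) (abs_nonneg _)
    · filter_upwards [ae_restrict_mem measurableSet_Ioo] with x hx
      refine tendsto_const_nhds.congr' ?_
      filter_upwards [eventually_cutoff_eq j p hx] with m hm
      rw [hm.self_of_nhds]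
  refine tendsto_nhds_unique T1 ((T2.const_mul ((-1) ^ j)).congr fun m => ?_)
  have h := isTestFun_cutoff j p m
  exact (H.2.2 _ h.contDiff h.hasCompactSupport h.tsupport_subset).symm

/-! ### The weighted seminorm in Legendre coefficients -/

theorem lintegral_sq_toLp {f : ℝ → ℝ} (hf : MemLp f 2 volI) :
    ∫⁻ x in Ioo (-1 : ℝ) 1, ENNReal.ofReal (f x ^ 2) = ENNReal.ofReal (‖hf.toLp f‖ ^ 2) := by
  rw [← real_inner_self_eq_norm_sq, inner_L2I,
    ← ofReal_integral_eq_lintegral_ofReal hf.integrable_sq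
      (Eventually.of_forall fun x => sq_nonneg (f x))]
  congr 1
  refine integral_congr_ae ?_
  filter_upwards [hf.coeFn_toLp] with x hx
  rw [hx, sq]

theorem sqrt_weight_mul_sq (j : ℕ) (y : ℝ) {x : ℝ} (hx : x ∈ Ioo (-1 : ℝ) 1) :
    (√(1 - x ^ 2) ^ j * y) ^ 2 = y ^ 2 * (1 - x ^ 2) ^ j := by
  rw [mul_pow, ← pow_mul, mul_comm j 2, pow_mul, Real.sq_sqrt (one_sub_sq_pos hx).le, mul_comm]

theorem lintegral_weight (j : ℕ) (g : ℝ → ℝ) :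
    ∫⁻ x in Ioo (-1 : ℝ) 1, ENNReal.ofReal (g x ^ 2 * (1 - x ^ 2) ^ j) =
      ∫⁻ x in Ioo (-1 : ℝ) 1, ENNReal.ofReal ((√(1 - x ^ 2) ^ j * g x) ^ 2) :=
  setLIntegral_congr_fun measurableSet_Ioo fun x hx => by rw [sqrt_weight_mul_sq j _ hx]

theorem memLp_sqrt_weight_mul_iff (j : ℕ) {g : ℝ → ℝ} (hg : AEStronglyMeasurable g volI) :
    MemLp (fun x => √(1 - x ^ 2) ^ j * g x) 2 volI ↔
      ∫⁻ x in Ioo (-1 : ℝ) 1, ENNReal.ofReal (g x ^ 2 * (1 - x ^ 2) ^ j) < ⊤ := by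
  have hm : AEStronglyMeasurable (fun x => √(1 - x ^ 2) ^ j * g x) volI :=
    (by fun_prop : Continuous fun x : ℝ => √(1 - x ^ 2) ^ j).aestronglyMeasurable.mul hg
  rw [lintegral_weight]
  constructor
  · intro h
    rw [lintegral_sq_toLp h]
    exact ENNReal.ofReal_lt_top
  · intro h
    rw [memLp_two_iff_integrable_sq hm]
    refine ⟨hm.pow 2, ?_⟩
    rw [hasFiniteIntegral_iff_ofReal (Eventually.of_forall fun x => sq_nonneg _)]
    exact h

theorem tsum_ofReal_inner_sq_le {ι : Type*} {v : ι → L2I} (hv : Orthonormal ℝ v) (h : L2I) :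
    ∑' i, ENNReal.ofReal (inner ℝ (v i) h ^ 2) ≤ ENNReal.ofReal (‖h‖ ^ 2) := by
  have h1 := hv.inner_products_summable h
  have h2 := hv.tsum_inner_products_le h
  simp only [Real.norm_eq_abs, sq_abs] at h1 h2
  rw [← ENNReal.ofReal_tsum_of_nonneg (fun i => sq_nonneg _) h1]
  exact ENNReal.ofReal_le_ofReal h2

theorem tsum_sqCoeff_mul_wt (u : L2I) (j : ℕ) :
    ∑' l, ENNReal.ofReal (sqCoeff u l * wt l j) =
      ∑' i, ENNReal.ofReal (sqCoeff u (i + j) * wt (i + j) j) := by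
  rw [← ENNReal.summable.sum_add_tsum_nat_add' (k := j), Finset.sum_eq_zero, zero_add]
  intro l hl
  rw [wt_eq_zero (Finset.mem_range.1 hl)]
  simp

/-- Bessel's inequality for `(1 - x²)^{j/2} g` in the system `weightedLegendre j`. Integration by
parts turns each inner product into a multiple of `legendreCoeff u l`. -/
theorem HasWeakDeriv.tsum_le_lintegral {j : ℕ} {u : L2I} {g : ℝ → ℝ} (H : HasWeakDeriv j u g) :
    ∑' l, ENNReal.ofReal (sqCoeff u l * wt l j) ≤
      ∫⁻ x in Ioo (-1 : ℝ) 1, ENNReal.ofReal (g x ^ 2 * (1 - x ^ 2) ^ j) := by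
  rcases eq_or_ne (∫⁻ x in Ioo (-1 : ℝ) 1, ENNReal.ofReal (g x ^ 2 * (1 - x ^ 2) ^ j)) ⊤ with h | h
  · rw [h]; exact le_top
  have hm := (memLp_sqrt_weight_mul_iff j H.aestronglyMeasurable).2 (lt_top_iff_ne_top.2 h)
  rw [lintegral_weight, lintegral_sq_toLp hm, tsum_sqCoeff_mul_wt]
  refine le_trans (le_of_eq (tsum_congr fun i => ?_))
    (tsum_ofReal_inner_sq_le (orthonormal_weightedLegendre j) (hm.toLp _))
  congr 1
  set l := i + j with hl
  set p := derivative^[j] (legendreP l) with hp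
  -- The half weight of the basis function and that of the `L²` function combine to the full weight
  -- `(1 - x²)^j`.
  have e1 : ∀ᵐ x ∂volI, √(1 - x ^ 2) ^ j * p.eval x * hm.toLp _ x =
      g x * ((1 - X ^ 2) ^ j * p).eval x := by
    filter_upwards [hm.coeFn_toLp, ae_restrict_mem measurableSet_Ioo] with x hx hI
    have : √(1 - x ^ 2) ^ j * √(1 - x ^ 2) ^ j = (1 - x ^ 2) ^ j := by
      rw [← mul_pow, Real.mul_self_sqrt (one_sub_sq_pos hI).le]
    simp only [hx, eval_mul, eval_pow, eval_sub, eval_one, eval_X]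
    rw [← this]
    ring
  have hint : IntegrableOn (fun x => g x * ((1 - X ^ 2) ^ j * p).eval x) (Ioo (-1 : ℝ) 1) := by
    have := MemLp.integrable_mul (memLp_weightedPoly j p) (Lp.memLp (hm.toLp _))
    exact this.congr e1
  have key : wt l j * legendreCoeff u l =
      ∫ x in Ioo (-1 : ℝ) 1, g x * ((1 - X ^ 2) ^ j * p).eval x := by
    have h1 := H.setIntegral_mul_weight (integrableOn_L2I u) p hint
    rw [hp, iterate_derivative_weight_mul_legendreP] at h1
    have e2 : ∀ x, u x * (C ((-1) ^ j * wt l j) * legendreP l).eval x =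
        ((-1) ^ j * wt l j) * (u x * (legendreP l).eval x) := by
      intro x
      rw [eval_C_mul]
      ring
    simp only [e2] at h1
    rw [integral_const_mul, mul_assoc] at h1
    exact mul_left_cancel₀ (pow_ne_zero _ (by norm_num)) h1
  have e3 : inner ℝ (weightedLegendre j i) (hm.toLp _) =
      normFactor j l * (wt l j * legendreCoeff u l) := by
    rw [weightedLegendre, real_inner_smul_left, inner_weightedPoly_left, key,
      ← integral_congr_ae e1]
  have hw : 0 < wt l j := wt_pos (Nat.le_add_left j i)
  rw [e3, mul_pow, normFactor, Real.sq_sqrt (div_nonneg (by positivity) hw.le), sqCoeff]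
  field_simp

theorem IsTestFun.memLp {φ : ℝ → ℝ} (h : IsTestFun φ) : MemLp φ 2 volI := by
  obtain ⟨C, hC⟩ := h.exists_bound
  exact MemLp.of_bound h.contDiff.continuous.aestronglyMeasurable C (Eventually.of_forall hC)

/-- The weight is bounded away from zero on the compact support of `φ`. Pairing `h / (1 - x²)^{j/2}`
with `φ` is thus an `L²` inner product. -/
theorem IsTestFun.memLp_inv_sqrt_weight_mul {φ : ℝ → ℝ} (h : IsTestFun φ) (j : ℕ) :
    MemLp (fun x => (√(1 - x ^ 2) ^ j)⁻¹ * φ x) 2 volI := by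
  obtain ⟨C, hC⟩ := h.exists_bound
  have hcont : ContinuousOn (fun x : ℝ => (√(1 - x ^ 2) ^ j)⁻¹) (tsupport φ) := by
    refine ContinuousOn.inv₀ (by fun_prop) fun x hx => ?_
    have := Real.sqrt_pos.2 (one_sub_sq_pos (h.tsupport_subset hx))
    positivity
  obtain ⟨D, hD⟩ := IsCompact.exists_bound_of_continuousOn h.hasCompactSupport hcont
  refine MemLp.of_bound ?_ (|D| * C) (Eventually.of_forall fun x => ?_)
  · refine AEStronglyMeasurable.mul ?_ h.contDiff.continuous.aestronglyMeasurable
    exact (by fun_prop : Continuous fun x : ℝ => √(1 - x ^ 2) ^ j).measurable.inv.aestronglyMeasurable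
  · have hC0 := (norm_nonneg _).trans (hC x)
    by_cases hx : x ∈ tsupport φ
    · rw [norm_mul]
      exact mul_le_mul ((hD x hx).trans (le_abs_self _)) (hC x) (norm_nonneg _) (abs_nonneg _)
    · rw [image_eq_zero_of_notMem_tsupport hx]
      simp only [mul_zero, norm_zero]
      positivity

theorem normFactor_zero (l : ℕ) : normFactor 0 l = √((2 * (l : ℝ) + 1) / 2) := by
  simp [normFactor]

theorem sqrt_wt_mul_normFactor {l j : ℕ} (h : j ≤ l) :
    √(wt l j) * normFactor j l = √((2 * (l : ℝ) + 1) / 2) := by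
  rw [normFactor, ← Real.sqrt_mul (wt_nonneg _ _)]
  have := (wt_pos h).ne'
  congr 1
  field_simp

/-- Termwise differentiation: the weighted derivative `h` is the series of `√(wt l j)` times the
coefficients of `u` in the system `weightedLegendre j`, convergent by hypothesis, and `g = h / (1 -
x²)^{j/2}`. Both sides of the weak identity are continuous functionals, so it is checked on each
`P_l`. -/
theorem exists_hasWeakDeriv_of_tsum_lt_top {j : ℕ} {u : L2I}
    (hfin : ∑' l, ENNReal.ofReal (sqCoeff u l * wt l j) < ⊤) :
    ∃ g : ℝ → ℝ, HasWeakDeriv j u g ∧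
      ∫⁻ x in Ioo (-1 : ℝ) 1, ENNReal.ofReal (g x ^ 2 * (1 - x ^ 2) ^ j) =
        ∑' l, ENNReal.ofReal (sqCoeff u l * wt l j) := by
  rw [tsum_sqCoeff_mul_wt] at hfin ⊢
  have hnn : ∀ i, 0 ≤ sqCoeff u (i + j) * wt (i + j) j :=
    fun i => mul_nonneg (sqCoeff_nonneg _ _) (wt_nonneg _ _)
  have hsum : Summable fun i => sqCoeff u (i + j) * wt (i + j) j := by
    have := ENNReal.summable_toReal hfin.ne
    exact this.congr fun i => ENNReal.toReal_ofReal (hnn i)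
  let f : ℕ → ℝ := fun i => legendreBasis.repr u (i + j) * √(wt (i + j) j)
  have hf : ∀ i, f i ^ 2 = sqCoeff u (i + j) * wt (i + j) j := by
    intro i
    simp only [f]
    rw [mul_pow, Real.sq_sqrt (wt_nonneg _ _), sqCoeff_eq_repr_sq]
  have hmem : Memℓp f 2 := by
    rw [memℓp_gen_iff (by norm_num)]
    refine hsum.congr fun i => ?_
    rw [← hf]
    simp
  let F : lp (fun _ : ℕ => ℝ) 2 := ⟨f, hmem⟩
  let V := (orthonormal_weightedLegendre j).orthogonalFamily
  let h : L2I := V.linearIsometry F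
  have hh : HasSum (fun i => f i • weightedLegendre j i) h := V.hasSum_linearIsometry F
  have hnorm : ‖h‖ ^ 2 = ∑' i, sqCoeff u (i + j) * wt (i + j) j := by
    rw [V.linearIsometry.norm_map, ← real_inner_self_eq_norm_sq, lp.inner_eq_tsum]
    refine tsum_congr fun i => ?_
    rw [← hf]
    simp [F, sq]
  have hcont : ContinuousOn (fun x : ℝ => (√(1 - x ^ 2) ^ j)⁻¹) (Ioo (-1 : ℝ) 1) := by
    refine ContinuousOn.inv₀ (by fun_prop) fun x hx => ?_
    have := Real.sqrt_pos.2 (one_sub_sq_pos hx)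
    positivity
  refine ⟨fun x => h x * (√(1 - x ^ 2) ^ j)⁻¹,
    ⟨(integrableOn_L2I u).locallyIntegrableOn,
      (integrableOn_L2I h).locallyIntegrableOn.mul_continuousOn hcont isOpen_Ioo.isLocallyClosed,
      fun φ h1 h2 h3 => ?_⟩, ?_⟩
  · have hφ : IsTestFun φ := ⟨h1, h2, h3⟩
    have m1 := (hφ.iteratedDeriv j).memLp
    have m2 := hφ.memLp_inv_sqrt_weight_mul j
    have L : ∫ x in Ioo (-1 : ℝ) 1, u x * iteratedDeriv j φ x = inner ℝ u (m1.toLp _) := by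
      rw [inner_L2I]
      refine integral_congr_ae ?_
      filter_upwards [m1.coeFn_toLp] with x hx
      rw [hx]
    have R : ∫ x in Ioo (-1 : ℝ) 1, h x * (√(1 - x ^ 2) ^ j)⁻¹ * φ x =
        inner ℝ h (m2.toLp _) := by
      rw [inner_L2I]
      refine integral_congr_ae ?_
      filter_upwards [m2.coeFn_toLp] with x hx
      rw [hx, mul_assoc]
    have S1 : HasSum (fun l => legendreBasis.repr u l *
        inner ℝ (weightedLegendre 0 l) (m1.toLp _)) (inner ℝ u (m1.toLp _)) := by
      have := (legendreBasis.hasSum_repr u).mapL (innerSL ℝ (m1.toLp (iteratedDeriv j φ)))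
      simp only [innerSL_apply_apply, real_inner_smul_right, legendreBasis_apply] at this
      simpa only [real_inner_comm] using this
    have S2 : HasSum (fun i => f i * inner ℝ (weightedLegendre j i) (m2.toLp _))
        (inner ℝ h (m2.toLp _)) := by
      have := hh.mapL (innerSL ℝ (m2.toLp (fun x => (√(1 - x ^ 2) ^ j)⁻¹ * φ x)))
      simp only [innerSL_apply_apply, real_inner_smul_right] at this
      simpa only [real_inner_comm] using this
    have i1 : ∀ l, inner ℝ (weightedLegendre 0 l) (m1.toLp _) = √((2 * (l : ℝ) + 1) / 2) *
        ((-1) ^ j * ∫ x in Ioo (-1 : ℝ) 1, (derivative^[j] (legendreP l)).eval x * φ x) := by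
      intro l
      rw [weightedLegendre, real_inner_smul_left, inner_weightedPoly_left, add_zero,
        normFactor_zero, ← hφ.setIntegral_polynomial_mul_iteratedDeriv]
      congr 1
      refine integral_congr_ae ?_
      filter_upwards [m1.coeFn_toLp] with x hx
      rw [hx]
      simp
    have i2 : ∀ i, inner ℝ (weightedLegendre j i) (m2.toLp _) = normFactor j (i + j) *
        ∫ x in Ioo (-1 : ℝ) 1, (derivative^[j] (legendreP (i + j))).eval x * φ x := by
      intro i
      rw [weightedLegendre, real_inner_smul_left, inner_weightedPoly_left]
      congr 1
      refine integral_congr_ae ?_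
      filter_upwards [m2.coeFn_toLp, ae_restrict_mem measurableSet_Ioo] with x hx hI
      rw [hx]
      have := Real.sqrt_pos.2 (one_sub_sq_pos hI)
      field_simp
    rw [L, R]
    -- The terms with `l < j` vanish because `P_l^{(j)} = 0`, so the expansion of `u` may be shifted
    -- by `j`.
    have S3 := (hasSum_nat_add_iff' j).2 S1
    rw [Finset.sum_eq_zero, sub_zero] at S3
    · refine S3.unique ((S2.mul_left ((-1) ^ j)).congr_fun ?_)
      intro i
      rw [i1, i2, ← sqrt_wt_mul_normFactor (Nat.le_add_left j i)]
      simp only [f]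
      ring
    · intro l hl
      rw [i1, iterate_derivative_legendreP_of_lt (Finset.mem_range.1 hl)]
      simp
  · have e : ∫⁻ x in Ioo (-1 : ℝ) 1,
        ENNReal.ofReal ((h x * (√(1 - x ^ 2) ^ j)⁻¹) ^ 2 * (1 - x ^ 2) ^ j) =
        ∫⁻ x in Ioo (-1 : ℝ) 1, ENNReal.ofReal (h x ^ 2) := by
      refine setLIntegral_congr_fun measurableSet_Ioo fun x hx => ?_
      rw [← sqrt_weight_mul_sq j _ hx]
      have := Real.sqrt_pos.2 (one_sub_sq_pos hx)
      congr 2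
      field_simp
    rw [e, lintegral_sq_toLp (Lp.memLp h), Lp.toLp_coeFn, hnorm,
      ENNReal.ofReal_tsum_of_nonneg hnn hsum]

theorem seminormSq_eq_tsum (j : ℕ) (u : L2I) :
    seminormSq j u = ∑' l, ENNReal.ofReal (sqCoeff u l * wt l j) := by
  refine le_antisymm ?_ (le_iInf₂ fun g hg => hg.tsum_le_lintegral)
  rcases eq_or_ne (∑' l, ENNReal.ofReal (sqCoeff u l * wt l j)) ⊤ with h | h
  · rw [h]; exact le_top
  · obtain ⟨g, hg, he⟩ := exists_hasWeakDeriv_of_tsum_lt_top (lt_top_iff_ne_top.2 h)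
    rw [← he]
    exact iInf₂_le g hg

/-! ### Comparison of the weights with powers of the frequency -/

/-- The frequency `max 1 l`. -/
noncomputable def freq (l : ℕ) : ℝ := max 1 (l : ℝ)

theorem one_le_freq (l : ℕ) : 1 ≤ freq l := le_max_left _ _

theorem freq_pos (l : ℕ) : 0 < freq l := zero_lt_one.trans_le (one_le_freq l)

theorem le_freq (l : ℕ) : (l : ℝ) ≤ freq l := le_max_right _ _

theorem freq_of_pos {l : ℕ} (h : 1 ≤ l) : freq l = l := max_eq_right (by exact_mod_cast h)

theorem wt_le (l j : ℕ) : wt l j ≤ 2 ^ j * freq l ^ (2 * j) := by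
  induction j with
  | zero => simp
  | succ j ih =>
    have h1 := one_le_freq l
    have h2 := le_freq l
    have h0 : (0 : ℝ) ≤ l := by positivity
    have hj : (0 : ℝ) ≤ j := by positivity
    have h3 : ((l : ℝ) - j) * (l + j + 1) ≤ 2 * freq l ^ 2 := by nlinarith
    rw [wt_succ]
    calc wt l j * (((l : ℝ) - j) * (l + j + 1)) ≤ wt l j * (2 * freq l ^ 2) :=
          mul_le_mul_of_nonneg_left h3 (wt_nonneg _ _)
      _ ≤ (2 ^ j * freq l ^ (2 * j)) * (2 * freq l ^ 2) :=
          mul_le_mul_of_nonneg_right ih (by positivity)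
      _ = 2 ^ (j + 1) * freq l ^ (2 * (j + 1)) := by ring

/-- Factor by factor, `l ≤ (i + 1)(l - i)` for `i < l`; the numbers `i + 1` multiply up to `j!`. -/
theorem pow_le_factorial_mul_wt {l j : ℕ} (h : j ≤ l) :
    (l : ℝ) ^ (2 * j) ≤ j.factorial * wt l j := by
  induction j with
  | zero => simp
  | succ j ih =>
    have ih := ih (by omega)
    have hl : (j : ℝ) + 1 ≤ l := by exact_mod_cast h
    have hj : (0 : ℝ) ≤ j := by positivity
    have h3 : (l : ℝ) ^ 2 ≤ (j + 1) * (((l : ℝ) - j) * (l + j + 1)) := by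
      have : (l : ℝ) ≤ (j + 1) * (l - j) := by nlinarith
      nlinarith
    rw [wt_succ, Nat.factorial_succ]
    push_cast
    calc (l : ℝ) ^ (2 * (j + 1)) = l ^ (2 * j) * l ^ 2 := by ring
      _ ≤ (j.factorial * wt l j) * ((j + 1) * (((l : ℝ) - j) * (l + j + 1))) :=
          mul_le_mul ih h3 (by positivity) (mul_nonneg (by positivity) (wt_nonneg _ _))
      _ = _ := by ring

/-- The weights of `‖·‖²_{V^n}` in the Legendre basis. -/
noncomputable def wtSum (n l : ℕ) : ℝ := ∑ j ∈ Finset.range (n + 1), wt l j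

theorem wt_le_wtSum {n j : ℕ} (l : ℕ) (h : j ≤ n) : wt l j ≤ wtSum n l :=
  Finset.single_le_sum (f := fun j => wt l j) (fun i _ => wt_nonneg l i)
    (Finset.mem_range.2 (by omega))

theorem exists_wtSum_le (n : ℕ) : ∃ C : ℝ, 0 < C ∧ ∀ l, wtSum n l ≤ C * freq l ^ (2 * n) := by
  refine ⟨∑ j ∈ Finset.range (n + 1), 2 ^ j,
    Finset.sum_pos (fun i _ => by positivity) ⟨0, by simp⟩, fun l => ?_⟩
  rw [wtSum, Finset.sum_mul]
  refine Finset.sum_le_sum fun j hj => (wt_le l j).trans ?_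
  have : j ≤ n := by have := Finset.mem_range.1 hj; omega
  exact mul_le_mul_of_nonneg_left (pow_le_pow_right₀ (one_le_freq l) (by omega)) (by positivity)

/-- The summand `1` handles the frequencies `l ≤ n`, where `freq l ≤ n + 1`, and `wt l n` handles
the rest. Only the zeroth and the top weights enter, so the intermediate seminorms are redundant. -/
theorem exists_le_one_add_wt (n : ℕ) :
    ∃ c : ℝ, 0 < c ∧ ∀ l, c * freq l ^ (2 * n) ≤ 1 + wt l n := by
  have hD : (0 : ℝ) < n.factorial + (n + 1 : ℝ) ^ (2 * n) := by positivity
  refine ⟨(n.factorial + (n + 1 : ℝ) ^ (2 * n))⁻¹, by positivity, fun l => ?_⟩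
  rw [inv_mul_le_iff₀ hD]
  have h4 : (0 : ℝ) < n.factorial := by positivity
  have h5 : (0 : ℝ) < (n + 1 : ℝ) ^ (2 * n) := by positivity
  have h6 := wt_nonneg l n
  rcases lt_or_ge l (n + 1) with h | h
  · have h1 : freq l ≤ n + 1 := by
      refine max_le (by linarith [(by positivity : (0 : ℝ) ≤ n)]) ?_
      exact_mod_cast h.le
    have h2 : freq l ^ (2 * n) ≤ (n + 1 : ℝ) ^ (2 * n) :=
      pow_le_pow_left₀ (freq_pos l).le h1 _
    nlinarith
  · rw [freq_of_pos (by omega)]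
    have := pow_le_factorial_mul_wt (by omega : n ≤ l)
    nlinarith

theorem exists_le_wtSum (n : ℕ) : ∃ c : ℝ, 0 < c ∧ ∀ l, c * freq l ^ (2 * n) ≤ wtSum n l := by
  obtain ⟨c, hc, h⟩ := exists_le_one_add_wt n
  refine ⟨c / 2, by positivity, fun l => ?_⟩
  have h0 := wt_le_wtSum l (Nat.zero_le n)
  rw [wt_zero] at h0
  linarith [h l, wt_le_wtSum l (le_refl n)]

theorem intNormSq_eq_tsum (n : ℕ) (u : L2I) :
    intNormSq n u = ∑' l, ENNReal.ofReal (sqCoeff u l * wtSum n l) := by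
  unfold intNormSq
  simp only [seminormSq_eq_tsum]
  rw [← Summable.tsum_finsetSum fun _ _ => ENNReal.summable]
  refine tsum_congr fun l => ?_
  rw [wtSum, Finset.mul_sum, ENNReal.ofReal_sum_of_nonneg]
  exact fun j _ => mul_nonneg (sqCoeff_nonneg _ _) (wt_nonneg _ _)

/-- The squared weighted `ℓ²`-norm `∑ a_l max(1, l)^{2σ}` of the Legendre coefficients. -/
noncomputable def specNormSq (σ : ℝ) (u : L2I) : ℝ≥0∞ :=
  ∑' l, ENNReal.ofReal (sqCoeff u l * freq l ^ (2 * σ))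

theorem freq_rpow_natCast (n l : ℕ) : freq l ^ (2 * (n : ℝ)) = freq l ^ (2 * n) := by
  rw [← Real.rpow_natCast]
  push_cast
  rfl

theorem exists_intNormSq_equiv (n : ℕ) : ∃ c C : ℝ, 0 < c ∧ 0 < C ∧ ∀ u : L2I,
    ENNReal.ofReal c * specNormSq n u ≤ intNormSq n u ∧
      intNormSq n u ≤ ENNReal.ofReal C * specNormSq n u := by
  obtain ⟨c, hc, H1⟩ := exists_le_wtSum n
  obtain ⟨C, hC, H2⟩ := exists_wtSum_le n
  refine ⟨c, C, hc, hC, fun u => ?_⟩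
  rw [intNormSq_eq_tsum, specNormSq, ← ENNReal.tsum_mul_left, ← ENNReal.tsum_mul_left]
  constructor <;> refine ENNReal.tsum_le_tsum fun l => ?_
  · rw [← ENNReal.ofReal_mul hc.le, freq_rpow_natCast]
    refine ENNReal.ofReal_le_ofReal ?_
    have := mul_le_mul_of_nonneg_left (H1 l) (sqCoeff_nonneg u l)
    linarith
  · rw [← ENNReal.ofReal_mul hC.le, freq_rpow_natCast]
    refine ENNReal.ofReal_le_ofReal ?_
    have := mul_le_mul_of_nonneg_left (H2 l) (sqCoeff_nonneg u l)
    linarith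

/-! ### Partial sums and density in `V^n` -/

/-- The partial sum of the Legendre expansion of `u` over a finite set of indices. -/
noncomputable def specProj (s : Finset ℕ) (u : L2I) : L2I :=
  ∑ l ∈ s, legendreBasis.repr u l • legendreBasis l

theorem repr_specProj (s : Finset ℕ) (u : L2I) (l : ℕ) :
    legendreBasis.repr (specProj s u) l = if l ∈ s then legendreBasis.repr u l else 0 := by
  rw [HilbertBasis.repr_apply_apply, specProj, inner_sum]
  simp only [real_inner_smul_right, orthonormal_iff_ite.1 legendreBasis.orthonormal]
  simp

theorem sqCoeff_specProj (s : Finset ℕ) (u : L2I) (l : ℕ) :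
    sqCoeff (specProj s u) l = if l ∈ s then sqCoeff u l else 0 := by
  rw [sqCoeff_eq_repr_sq, sqCoeff_eq_repr_sq, repr_specProj]
  split_ifs <;> simp

theorem sqCoeff_sub_specProj (s : Finset ℕ) (u : L2I) (l : ℕ) :
    sqCoeff (u - specProj s u) l = if l ∈ s then 0 else sqCoeff u l := by
  rw [sqCoeff_eq_repr_sq, sqCoeff_eq_repr_sq, map_sub, lp.coeFn_sub, Pi.sub_apply, repr_specProj]
  split_ifs <;> simp

theorem weightedPoly_add (j : ℕ) (p q : ℝ[X]) :
    weightedPoly j (p + q) = weightedPoly j p + weightedPoly j q := by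
  unfold weightedPoly
  rw [← MemLp.toLp_add]
  refine MemLp.toLp_congr _ _ (Eventually.of_forall fun x => ?_)
  simp [mul_add]

theorem weightedPoly_C_mul (j : ℕ) (c : ℝ) (p : ℝ[X]) :
    weightedPoly j (C c * p) = c • weightedPoly j p := by
  unfold weightedPoly
  rw [← MemLp.toLp_const_smul]
  refine MemLp.toLp_congr _ _ (Eventually.of_forall fun x => ?_)
  simp
  ring

theorem weightedPoly_zero_right (j : ℕ) : weightedPoly j 0 = 0 := by
  simpa using weightedPoly_C_mul j 0 0

theorem exists_specProj_eq_weightedPoly (s : Finset ℕ) (u : L2I) :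
    ∃ q : ℝ[X], specProj s u = weightedPoly 0 q := by
  unfold specProj
  induction s using Finset.induction_on with
  | empty => exact ⟨0, by simp [weightedPoly_zero_right]⟩
  | insert l s hl ih =>
    obtain ⟨q, hq⟩ := ih
    refine ⟨C (legendreBasis.repr u l * normFactor 0 l) * legendreP l + q, ?_⟩
    rw [Finset.sum_insert hl, hq, weightedPoly_add, weightedPoly_C_mul, legendreBasis_apply,
      weightedLegendre, smul_smul]
    simp

theorem weightedPoly_zero_mem_sobolevH (n : ℕ) (q : ℝ[X]) : weightedPoly 0 q ∈ sobolevH n := by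
  intro j _
  refine ⟨fun x => (derivative^[j] q).eval x, (hasWeakDeriv_polynomial j q).congr ?_
    EventuallyEq.rfl, ?_⟩
  · filter_upwards [coeFn_weightedPoly 0 q] with x hx
    rw [hx]
    simp
  · simpa using memLp_weightedPoly 0 (derivative^[j] q)

theorem intNorm_lt_top_iff (n : ℕ) (u : L2I) : intNorm n u < ⊤ ↔ intNormSq n u < ⊤ :=
  ENNReal.rpow_lt_top_iff_of_pos (by norm_num)

theorem intNorm_sq (n : ℕ) (u : L2I) : intNorm n u ^ 2 = intNormSq n u := by
  rw [intNorm, ← ENNReal.rpow_natCast, ← ENNReal.rpow_mul]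
  norm_num

/-- The closure is everything of finite norm: Legendre partial sums are polynomials, hence in `H^n`,
and the error is the tail of a convergent series. -/
theorem mem_intV_iff (n : ℕ) (u : L2I) : u ∈ intV n ↔ intNormSq n u < ⊤ := by
  rw [← intNorm_lt_top_iff]
  refine ⟨fun h => h.1, fun h => ⟨h, fun k => specProj (Finset.range k) u, fun k => ?_, ?_⟩⟩
  · obtain ⟨q, hq⟩ := exists_specProj_eq_weightedPoly (Finset.range k) u
    simp only [hq]
    exact weightedPoly_zero_mem_sobolevH n q
  · rw [intNorm_lt_top_iff, intNormSq_eq_tsum] at h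
    have T := ENNReal.tendsto_sum_nat_add _ h.ne
    have e : ∀ k, intNorm n (u - specProj (Finset.range k) u) =
        (∑' l, ENNReal.ofReal (sqCoeff u (l + k) * wtSum n (l + k))) ^ (1 / 2 : ℝ) := by
      intro k
      rw [intNorm, intNormSq_eq_tsum, ← ENNReal.summable.sum_add_tsum_nat_add' (k := k),
        Finset.sum_eq_zero, zero_add]
      · congr 1
        refine tsum_congr fun l => ?_
        rw [sqCoeff_sub_specProj, if_neg (by simp)]
      · intro l hl
        rw [sqCoeff_sub_specProj, if_pos hl]
        simp
    simp only [e]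
    have := (ENNReal.continuous_rpow_const (y := (1 / 2 : ℝ))).tendsto (0 : ℝ≥0∞)
    rw [ENNReal.zero_rpow_of_pos (by norm_num)] at this
    exact this.comp T

theorem mem_intV_iff_specNormSq (n : ℕ) (u : L2I) : u ∈ intV n ↔ specNormSq n u < ⊤ := by
  obtain ⟨c, C, hc, hC, h⟩ := exists_intNormSq_equiv n
  rw [mem_intV_iff]
  constructor
  · intro h1
    have := (h u).1.trans_lt h1
    by_contra h2
    rw [not_lt, top_le_iff] at h2
    rw [h2, ENNReal.mul_top (by simpa using hc)] at this
    exact lt_irrefl _ this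
  · intro h1
    exact (h u).2.trans_lt (ENNReal.mul_lt_top ENNReal.ofReal_lt_top h1)

/-! ### The `K`-functional and real interpolation -/

theorem ennreal_add_sq_le (a b : ℝ≥0∞) : (a + b) ^ 2 ≤ 4 * (a ^ 2 + b ^ 2) := by
  have key : ∀ a b : ℝ≥0∞, a ≤ b → (a + b) ^ 2 ≤ 4 * (a ^ 2 + b ^ 2) := by
    intro a b h
    calc (a + b) ^ 2 ≤ (b + b) ^ 2 := by gcongr
      _ = 4 * b ^ 2 := by ring
      _ ≤ 4 * (a ^ 2 + b ^ 2) := by gcongr; exact le_add_self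
  rcases le_total a b with h | h
  · exact key a b h
  · rw [add_comm a b, add_comm (a ^ 2)]
    exact key b a h

theorem ennreal_sq_add_sq_le (a b : ℝ≥0∞) : a ^ 2 + b ^ 2 ≤ (a + b) ^ 2 := by
  have : (a + b) ^ 2 = a ^ 2 + b ^ 2 + 2 * a * b := by ring
  rw [this]
  exact le_self_add

/-- The spectral form of the square of the `K`-functional of `(V^n, V^{n+1})`. -/
noncomputable def specK (n : ℕ) (t : ℝ) (u : L2I) : ℝ≥0∞ :=
  ∑' l, ENNReal.ofReal (sqCoeff u l * freq l ^ (2 * n) * min 1 ((t * freq l) ^ 2))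

theorem sqCoeff_add_le (v w : L2I) (l : ℕ) :
    sqCoeff (v + w) l ≤ 2 * sqCoeff v l + 2 * sqCoeff w l := by
  simp only [sqCoeff_eq_repr_sq, map_add, lp.coeFn_add, Pi.add_apply]
  nlinarith [sq_nonneg (legendreBasis.repr v l - legendreBasis.repr w l)]

/-- The minimum is bounded by `1` on the `v` part and by `(t * freq l)²` on the `w` part. Valid for
every splitting, this gives the lower bound for `K`. -/
theorem specK_add_le (n : ℕ) (t : ℝ) (v w : L2I) :
    specK n t (v + w) ≤
      2 * (specNormSq n v + ENNReal.ofReal (t ^ 2) * specNormSq ((n + 1 : ℕ) : ℝ) w) := by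
  unfold specK specNormSq
  rw [← ENNReal.tsum_mul_left, ← ENNReal.tsum_add, ← ENNReal.tsum_mul_left]
  refine ENNReal.tsum_le_tsum fun l => ?_
  have hv := sqCoeff_nonneg v l
  have hw := sqCoeff_nonneg w l
  have hf := freq_pos l
  have hle := sqCoeff_add_le v w l
  have h2 : (2 : ℝ≥0∞) = ENNReal.ofReal 2 := by simp
  generalize sqCoeff (v + w) l = a at hle ⊢
  rw [freq_rpow_natCast, freq_rpow_natCast, h2, ← ENNReal.ofReal_mul (sq_nonneg t),
    ← ENNReal.ofReal_add (by positivity) (by positivity), ← ENNReal.ofReal_mul (by norm_num)]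
  refine ENNReal.ofReal_le_ofReal ?_
  set M := freq l ^ (2 * n) with hM
  have hM0 : 0 < M := by positivity
  set μ := min 1 ((t * freq l) ^ 2) with hμ
  have hμ0 : 0 ≤ μ := le_min zero_le_one (sq_nonneg _)
  have h3 : sqCoeff v l * M * μ ≤ sqCoeff v l * M :=
    mul_le_of_le_one_right (by positivity) (min_le_left _ _)
  have h4 : sqCoeff w l * M * μ ≤ sqCoeff w l * M * (t * freq l) ^ 2 :=
    mul_le_mul_of_nonneg_left (min_le_right _ _) (by positivity)
  calc a * M * μ ≤ (2 * sqCoeff v l + 2 * sqCoeff w l) * M * μ := by gcongr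
    _ = 2 * (sqCoeff v l * M * μ) + 2 * (sqCoeff w l * M * μ) := by ring
    _ ≤ 2 * (sqCoeff v l * M) + 2 * (sqCoeff w l * M * (t * freq l) ^ 2) := by linarith
    _ = _ := by rw [hM]; ring

/-- The sharp frequency cut: `w` takes the modes with `t * freq l ≤ 1`, `v` the others, so each mode
attains the minimum in `specK`. -/
theorem exists_split_specK (n : ℕ) {t : ℝ} (ht : 0 < t) (u : L2I) :
    ∃ v w : L2I, u = v + w ∧
      specNormSq n v + ENNReal.ofReal (t ^ 2) * specNormSq ((n + 1 : ℕ) : ℝ) w = specK n t u := by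
  classical
  -- The range only certifies finiteness: `t * freq l ≤ 1` forces `l ≤ 1 / t`.
  let s : Finset ℕ := (Finset.range (⌈1 / t⌉₊ + 1)).filter fun l => t * freq l ≤ 1
  have hs : ∀ l, l ∈ s ↔ t * freq l ≤ 1 := by
    intro l
    simp only [s, Finset.mem_filter, Finset.mem_range, and_iff_right_iff_imp]
    intro h
    have h1 : (l : ℝ) ≤ 1 / t := by
      rw [le_div_iff₀ ht]
      nlinarith [le_freq l]
    have h2 : (l : ℝ) ≤ ⌈1 / t⌉₊ := h1.trans (Nat.le_ceil _)
    have : l ≤ ⌈1 / t⌉₊ := by exact_mod_cast h2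
    omega
  refine ⟨u - specProj s u, specProj s u, by simp, ?_⟩
  unfold specK specNormSq
  rw [← ENNReal.tsum_mul_left, ← ENNReal.tsum_add]
  refine tsum_congr fun l => ?_
  rw [sqCoeff_specProj, sqCoeff_sub_specProj, ← ENNReal.ofReal_mul (sq_nonneg t),
    freq_rpow_natCast, freq_rpow_natCast]
  have hf := freq_pos l
  by_cases h : l ∈ s
  · have h1 : (t * freq l) ^ 2 ≤ 1 := pow_le_one₀ (by positivity) ((hs l).1 h)
    rw [if_pos h, if_pos h, min_eq_right h1, zero_mul, ENNReal.ofReal_zero, zero_add]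
    congr 1
    ring
  · have h1 : 1 ≤ (t * freq l) ^ 2 := one_le_pow₀ (not_le.1 fun h' => h ((hs l).2 h')).le
    rw [if_neg h, if_neg h, min_eq_left h1]
    simp

theorem exists_kFunctional_equiv (n : ℕ) : ∃ c C : ℝ, 0 < c ∧ 0 < C ∧ ∀ (u : L2I) (t : ℝ), 0 < t →
    ENNReal.ofReal c * specK n t u ≤ kFunctional n t u ^ 2 ∧
      kFunctional n t u ^ 2 ≤ ENNReal.ofReal C * specK n t u := by
  obtain ⟨c1, C1, hc1, hC1, H1⟩ := exists_intNormSq_equiv n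
  obtain ⟨c2, C2, hc2, hC2, H2⟩ := exists_intNormSq_equiv (n + 1)
  refine ⟨min c1 c2 / 2, 4 * max C1 C2, by positivity, by positivity, fun u t ht => ⟨?_, ?_⟩⟩
  -- The infimum defines `K` rather than `K²`, so the bound is proved for the square root and
  -- squared afterwards.
  · have key : (ENNReal.ofReal (min c1 c2 / 2) * specK n t u) ^ (1 / 2 : ℝ) ≤
        kFunctional n t u := by
      refine le_iInf₂ fun v _ => le_iInf₂ fun w _ => le_iInf fun huv => ?_
      have : ENNReal.ofReal (min c1 c2 / 2) * specK n t u ≤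
          (intNorm n v + ENNReal.ofReal t * intNorm (n + 1) w) ^ 2 := by
        refine le_trans ?_ (ennreal_sq_add_sq_le _ _)
        rw [mul_pow, intNorm_sq, intNorm_sq, ← ENNReal.ofReal_pow ht.le, huv]
        have e : ENNReal.ofReal (min c1 c2 / 2) * 2 = ENNReal.ofReal (min c1 c2) := by
          rw [show (2 : ℝ≥0∞) = ENNReal.ofReal 2 by simp, ← ENNReal.ofReal_mul (by positivity)]
          congr 1
          ring
        calc _ ≤ ENNReal.ofReal (min c1 c2 / 2) * (2 * (specNormSq n v +
              ENNReal.ofReal (t ^ 2) * specNormSq ((n + 1 : ℕ) : ℝ) w)) := by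
              gcongr
              exact specK_add_le n t v w
          _ = ENNReal.ofReal (min c1 c2) * specNormSq n v + ENNReal.ofReal (t ^ 2) *
              (ENNReal.ofReal (min c1 c2) * specNormSq ((n + 1 : ℕ) : ℝ) w) := by
              rw [← mul_assoc, e]
              ring
          _ ≤ _ := by
              gcongr
              · refine le_trans ?_ (H1 v).1
                gcongr
                exact min_le_left _ _
              · refine le_trans ?_ (H2 w).1
                gcongr
                exact min_le_right _ _
      calc _ ≤ ((intNorm n v + ENNReal.ofReal t * intNorm (n + 1) w) ^ 2) ^ (1 / 2 : ℝ) := by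
            gcongr
        _ = _ := by
            rw [← ENNReal.rpow_natCast, ← ENNReal.rpow_mul]
            norm_num
    calc _ = ((ENNReal.ofReal (min c1 c2 / 2) * specK n t u) ^ (1 / 2 : ℝ)) ^ 2 := by
          rw [← ENNReal.rpow_natCast, ← ENNReal.rpow_mul]
          norm_num
      _ ≤ _ := by gcongr
  · rcases eq_or_ne (specK n t u) ⊤ with h | h
    · rw [h, ENNReal.mul_top (ENNReal.ofReal_pos.2 (by positivity)).ne']
      exact le_top
    obtain ⟨v, w, huv, hs⟩ := exists_split_specK n ht u
    have hfin : specNormSq n v + ENNReal.ofReal (t ^ 2) * specNormSq ((n + 1 : ℕ) : ℝ) w < ⊤ := by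
      rw [hs]
      exact lt_top_iff_ne_top.2 h
    rw [ENNReal.add_lt_top] at hfin
    have hw : specNormSq ((n + 1 : ℕ) : ℝ) w < ⊤ := by
      by_contra h2
      rw [not_lt, top_le_iff] at h2
      rw [h2, ENNReal.mul_top (by simpa using ht.ne')] at hfin
      exact lt_irrefl _ hfin.2
    have hk : kFunctional n t u ≤ intNorm n v + ENNReal.ofReal t * intNorm (n + 1) w :=
      iInf₂_le_of_le v ((mem_intV_iff_specNormSq n v).2 hfin.1) <|
        iInf₂_le_of_le w ((mem_intV_iff_specNormSq (n + 1) w).2 hw) <| iInf_le_of_le huv le_rfl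
    calc kFunctional n t u ^ 2 ≤ (intNorm n v + ENNReal.ofReal t * intNorm (n + 1) w) ^ 2 := by
          gcongr
      _ ≤ 4 * (intNorm n v ^ 2 + (ENNReal.ofReal t * intNorm (n + 1) w) ^ 2) :=
          ennreal_add_sq_le _ _
      _ = 4 * (intNormSq n v + ENNReal.ofReal (t ^ 2) * intNormSq (n + 1) w) := by
          rw [mul_pow, intNorm_sq, intNorm_sq, ← ENNReal.ofReal_pow ht.le]
      _ ≤ 4 * (ENNReal.ofReal (max C1 C2) * specNormSq n v + ENNReal.ofReal (t ^ 2) *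
            (ENNReal.ofReal (max C1 C2) * specNormSq ((n + 1 : ℕ) : ℝ) w)) := by
          gcongr
          · refine (H1 v).2.trans ?_
            gcongr
            exact le_max_left _ _
          · refine (H2 w).2.trans ?_
            gcongr
            exact le_max_right _ _
      _ = 4 * ENNReal.ofReal (max C1 C2) * (specNormSq n v +
            ENNReal.ofReal (t ^ 2) * specNormSq ((n + 1 : ℕ) : ℝ) w) := by ring
      _ = _ := by
          rw [hs, ENNReal.ofReal_mul (by norm_num)]
          simp

/-- The minimum switches at `t = 1/m`: the integrand is `m² t^(1-2θ)` before and `t^(-2θ-1)` after.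
Convergence at `0` needs `θ < 1`, at infinity `θ > 0`. -/
theorem lintegral_min_kernel {θ m : ℝ} (h0 : 0 < θ) (h1 : θ < 1) (hm : 0 < m) :
    ∫⁻ t in Ioi (0 : ℝ), ENNReal.ofReal (t ^ (-2 * θ) * min 1 ((t * m) ^ 2) * (1 / t)) =
      ENNReal.ofReal ((1 / (2 - 2 * θ) + 1 / (2 * θ)) * m ^ (2 * θ)) := by
  have hm1 : 0 < 1 / m := by positivity
  rw [← Ioc_union_Ioi_eq_Ioi hm1.le, lintegral_union measurableSet_Ioi
    (Set.Ioc_disjoint_Ioi le_rfl)]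
  have e1 : ∫⁻ t in Ioc 0 (1 / m),
      ENNReal.ofReal (t ^ (-2 * θ) * min 1 ((t * m) ^ 2) * (1 / t)) =
      ENNReal.ofReal (1 / (2 - 2 * θ) * m ^ (2 * θ)) := by
    have hi : IntegrableOn (fun t : ℝ => m ^ 2 * t ^ (1 - 2 * θ)) (Ioc 0 (1 / m)) :=
      ((intervalIntegrable_iff_integrableOn_Ioc_of_le hm1.le).1
        (intervalIntegral.intervalIntegrable_rpow' (by linarith))).const_mul _
    have hc : ∫ t in Ioc 0 (1 / m), m ^ 2 * t ^ (1 - 2 * θ) =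
        1 / (2 - 2 * θ) * m ^ (2 * θ) := by
      rw [integral_const_mul, ← intervalIntegral.integral_of_le hm1.le,
        integral_rpow (Or.inl (by linarith)), Real.zero_rpow (by linarith), sub_zero,
        show 1 - 2 * θ + 1 = 2 - 2 * θ by ring, one_div m, Real.inv_rpow hm.le,
        Real.rpow_sub hm]
      have := Real.rpow_pos_of_pos hm (2 * θ)
      have : 2 - 2 * θ ≠ 0 := by linarith
      rw [Real.rpow_two]
      field_simp
    rw [← hc, ofReal_integral_eq_lintegral_ofReal hi]
    · refine setLIntegral_congr_fun measurableSet_Ioc fun t ht => ?_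
      have hle : (t * m) ^ 2 ≤ 1 := by
        refine pow_le_one₀ (mul_nonneg ht.1.le hm.le) ?_
        have := ht.2
        rwa [le_div_iff₀ hm] at this
      rw [min_eq_right hle, show 1 - 2 * θ = -2 * θ + 1 by ring, Real.rpow_add ht.1,
        Real.rpow_one]
      have := ht.1
      congr 1
      field_simp
    · filter_upwards [ae_restrict_mem measurableSet_Ioc] with t ht
      have := Real.rpow_nonneg ht.1.le (1 - 2 * θ)
      exact mul_nonneg (sq_nonneg m) this
  have e2 : ∫⁻ t in Ioi (1 / m),
      ENNReal.ofReal (t ^ (-2 * θ) * min 1 ((t * m) ^ 2) * (1 / t)) =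
      ENNReal.ofReal (1 / (2 * θ) * m ^ (2 * θ)) := by
    have hi : IntegrableOn (fun t : ℝ => t ^ (-2 * θ - 1)) (Ioi (1 / m)) :=
      integrableOn_Ioi_rpow_of_lt (by linarith) hm1
    have hc : ∫ t in Ioi (1 / m), t ^ (-2 * θ - 1) = 1 / (2 * θ) * m ^ (2 * θ) := by
      rw [integral_Ioi_rpow_of_lt (by linarith) hm1, show -2 * θ - 1 + 1 = -(2 * θ) by ring,
        one_div m, Real.inv_rpow hm.le, Real.rpow_neg hm.le, inv_inv]
      field_simp
    rw [← hc, ofReal_integral_eq_lintegral_ofReal hi]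
    · refine setLIntegral_congr_fun measurableSet_Ioi fun t ht => ?_
      have ht : 1 / m < t := ht
      have ht0 : 0 < t := hm1.trans ht
      have hle : 1 ≤ (t * m) ^ 2 := by
        refine one_le_pow₀ ?_
        rw [div_lt_iff₀ hm] at ht
        exact ht.le
      rw [min_eq_left hle, Real.rpow_sub ht0, Real.rpow_one, mul_one, mul_one_div]
    · filter_upwards [ae_restrict_mem measurableSet_Ioi] with t ht
      exact Real.rpow_nonneg (hm1.trans ht).le _
  have hp := Real.rpow_pos_of_pos hm (2 * θ)
  have h2 : 0 < 2 - 2 * θ := by linarith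
  rw [e1, e2, ← ENNReal.ofReal_add (by positivity) (by positivity), add_mul]

theorem lintegral_specK {θ : ℝ} (h0 : 0 < θ) (h1 : θ < 1) (n : ℕ) (u : L2I) :
    ∫⁻ t in Ioi (0 : ℝ), ENNReal.ofReal (t ^ (-2 * θ)) * specK n t u * ENNReal.ofReal (1 / t) =
      ENNReal.ofReal (1 / (2 - 2 * θ) + 1 / (2 * θ)) * specNormSq (n + θ) u := by
  have hκ : 0 < 1 / (2 - 2 * θ) + 1 / (2 * θ) := by
    have h2 : 0 < 2 - 2 * θ := by linarith
    positivity
  have e : ∀ t ∈ Ioi (0 : ℝ),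
      ENNReal.ofReal (t ^ (-2 * θ)) * specK n t u * ENNReal.ofReal (1 / t) =
      ∑' l, ENNReal.ofReal (sqCoeff u l * freq l ^ (2 * n)) *
        ENNReal.ofReal (t ^ (-2 * θ) * min 1 ((t * freq l) ^ 2) * (1 / t)) := by
    intro t ht
    have ht : 0 < t := ht
    rw [specK, ← ENNReal.tsum_mul_left, ← ENNReal.tsum_mul_right]
    refine tsum_congr fun l => ?_
    have ha := sqCoeff_nonneg u l
    have hf := freq_pos l
    have hp := Real.rpow_pos_of_pos ht (-2 * θ)
    have hμ : 0 ≤ min 1 ((t * freq l) ^ 2) := le_min zero_le_one (sq_nonneg _)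
    rw [← ENNReal.ofReal_mul (by positivity), ← ENNReal.ofReal_mul (by positivity),
      ← ENNReal.ofReal_mul (by positivity)]
    congr 1
    ring
  rw [setLIntegral_congr_fun measurableSet_Ioi e, lintegral_tsum fun l => by fun_prop, specNormSq,
    ← ENNReal.tsum_mul_left]
  refine tsum_congr fun l => ?_
  have ha := sqCoeff_nonneg u l
  have hf := freq_pos l
  rw [lintegral_const_mul _ (by fun_prop), lintegral_min_kernel h0 h1 hf,
    ← ENNReal.ofReal_mul (by positivity), ← ENNReal.ofReal_mul hκ.le, mul_add,
    Real.rpow_add hf, freq_rpow_natCast]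
  congr 1
  ring

theorem exists_interpNormSq_equiv (n : ℕ) {θ : ℝ} (h0 : 0 < θ) (h1 : θ < 1) :
    ∃ c C : ℝ, 0 < c ∧ 0 < C ∧ ∀ u : L2I,
      ENNReal.ofReal c * specNormSq (n + θ) u ≤ interpNormSq n θ u ∧
        interpNormSq n θ u ≤ ENNReal.ofReal C * specNormSq (n + θ) u := by
  obtain ⟨c, C, hc, hC, H⟩ := exists_kFunctional_equiv n
  have hκ : 0 < 1 / (2 - 2 * θ) + 1 / (2 * θ) := by
    have h2 : 0 < 2 - 2 * θ := by linarith
    positivity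
  set κ := 1 / (2 - 2 * θ) + 1 / (2 * θ) with hκd
  have pull : ∀ (d : ℝ) (u : L2I), 0 < d →
      ENNReal.ofReal (d * κ) * specNormSq (n + θ) u =
      ∫⁻ t in Ioi (0 : ℝ), ENNReal.ofReal (t ^ (-2 * θ)) *
        (ENNReal.ofReal d * specK n t u) * ENNReal.ofReal (1 / t) := by
    intro d u hd
    rw [ENNReal.ofReal_mul hd.le, mul_assoc, ← lintegral_specK h0 h1,
      ← lintegral_const_mul' _ _ ENNReal.ofReal_ne_top]
    refine lintegral_congr fun t => ?_
    ring
  refine ⟨c * κ, C * κ, by positivity, by positivity, fun u => ⟨?_, ?_⟩⟩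
  · rw [pull c u hc]
    refine setLIntegral_mono' measurableSet_Ioi fun t ht => ?_
    gcongr
    exact (H u t ht).1
  · rw [pull C u hC]
    refine setLIntegral_mono' measurableSet_Ioi fun t ht => ?_
    gcongr
    exact (H u t ht).2

/-! ### The spaces `V^η` and the equivalent norm -/

theorem exists_normSqV_equiv {η : ℝ} (hη : 0 ≤ η) : ∃ c C : ℝ, 0 < c ∧ 0 < C ∧ ∀ u : L2I,
    ENNReal.ofReal c * specNormSq η u ≤ normSqV η u ∧
      normSqV η u ≤ ENNReal.ofReal C * specNormSq η u := by
  unfold normSqV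
  split_ifs with h
  · have := exists_intNormSq_equiv ⌊η⌋₊
    rwa [← h] at this
  · have h1 : (⌊η⌋₊ : ℝ) < η := lt_of_le_of_ne (Nat.floor_le hη) (Ne.symm h)
    have h2 := Nat.lt_floor_add_one η
    have := exists_interpNormSq_equiv ⌊η⌋₊ (θ := η - ⌊η⌋₊) (by linarith) (by linarith)
    rwa [add_sub_cancel] at this

theorem mem_spaceV_iff_normSqV (η : ℝ) (u : L2I) : u ∈ spaceV η ↔ normSqV η u < ⊤ := by
  unfold spaceV normSqV
  split_ifs with h
  · exact mem_intV_iff _ u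
  · rfl

theorem mem_spaceV_iff_specNormSq {η : ℝ} (hη : 0 ≤ η) (u : L2I) :
    u ∈ spaceV η ↔ specNormSq η u < ⊤ := by
  obtain ⟨c, C, hc, hC, h⟩ := exists_normSqV_equiv hη
  rw [mem_spaceV_iff_normSqV]
  constructor
  · intro h1
    have := (h u).1.trans_lt h1
    by_contra h2
    rw [not_lt, top_le_iff] at h2
    rw [h2, ENNReal.mul_top (by simpa using hc)] at this
    exact lt_irrefl _ this
  · intro h1
    exact (h u).2.trans_lt (ENNReal.mul_lt_top ENNReal.ofReal_lt_top h1)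

theorem summable_iff_tsum_ofReal_lt_top {ι : Type*} {f : ι → ℝ} (hf : ∀ i, 0 ≤ f i) :
    Summable f ↔ ∑' i, ENNReal.ofReal (f i) < ⊤ := by
  refine ⟨fun h => ?_, fun h => ?_⟩
  · rw [← ENNReal.ofReal_tsum_of_nonneg hf h]
    exact ENNReal.ofReal_lt_top
  · exact (ENNReal.summable_toReal h.ne).congr fun i => ENNReal.toReal_ofReal (hf i)

theorem spectralTerm_eq (η : ℝ) (u : L2I) (l : ℕ) :
    spectralTerm η u l = sqCoeff u l * (1 + (l : ℝ) ^ (2 * η)) := rfl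

theorem one_add_rpow_nonneg (η : ℝ) (l : ℕ) : 0 ≤ 1 + (l : ℝ) ^ (2 * η) :=
  add_nonneg zero_le_one (Real.rpow_nonneg (by positivity) _)

theorem spectralTerm_nonneg (η : ℝ) (u : L2I) (l : ℕ) : 0 ≤ spectralTerm η u l :=
  mul_nonneg (sqCoeff_nonneg u l) (one_add_rpow_nonneg η l)

theorem freq_rpow_le {η : ℝ} (l : ℕ) : freq l ^ (2 * η) ≤ 1 + (l : ℝ) ^ (2 * η) := by
  rcases Nat.eq_zero_or_pos l with rfl | h
  · have : freq 0 = 1 := by simp [freq]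
    rw [this, Real.one_rpow]
    exact le_add_of_nonneg_right (Real.rpow_nonneg (by positivity) _)
  · rw [freq_of_pos h]
    linarith

theorem one_add_rpow_le {η : ℝ} (hη : 0 ≤ η) (l : ℕ) :
    1 + (l : ℝ) ^ (2 * η) ≤ 2 * freq l ^ (2 * η) := by
  have h1 := Real.one_le_rpow (one_le_freq l) (by linarith : 0 ≤ 2 * η)
  have h2 := Real.rpow_le_rpow (by positivity) (le_freq l) (by linarith : 0 ≤ 2 * η)
  linarith

theorem specNormSq_le_tsum_spectralTerm (η : ℝ) (u : L2I) :
    specNormSq η u ≤ ∑' l, ENNReal.ofReal (spectralTerm η u l) :=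
  ENNReal.tsum_le_tsum fun l => ENNReal.ofReal_le_ofReal <|
    mul_le_mul_of_nonneg_left (freq_rpow_le l) (sqCoeff_nonneg u l)

theorem tsum_spectralTerm_le {η : ℝ} (hη : 0 ≤ η) (u : L2I) :
    ∑' l, ENNReal.ofReal (spectralTerm η u l) ≤ ENNReal.ofReal 2 * specNormSq η u := by
  rw [specNormSq, ← ENNReal.tsum_mul_left]
  refine ENNReal.tsum_le_tsum fun l => ?_
  rw [← ENNReal.ofReal_mul (by norm_num)]
  refine ENNReal.ofReal_le_ofReal ?_
  have := mul_le_mul_of_nonneg_left (one_add_rpow_le hη l) (sqCoeff_nonneg u l)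
  rw [spectralTerm_eq]
  linarith

theorem mem_spaceV_iff_summable {η : ℝ} (hη : 0 ≤ η) (u : L2I) :
    u ∈ spaceV η ↔ Summable (spectralTerm η u) := by
  rw [mem_spaceV_iff_specNormSq hη, summable_iff_tsum_ofReal_lt_top (spectralTerm_nonneg η u)]
  exact ⟨fun h => (tsum_spectralTerm_le hη u).trans_lt
    (ENNReal.mul_lt_top ENNReal.ofReal_lt_top h),
    fun h => (specNormSq_le_tsum_spectralTerm η u).trans_lt h⟩

/-- The Legendre coefficients, scaled so that their `ℓ²`-norm is `N_η`. -/
noncomputable def scaledCoeff (η : ℝ) (u : L2I) (l : ℕ) : ℝ :=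
  √(1 + (l : ℝ) ^ (2 * η)) * legendreBasis.repr u l

theorem scaledCoeff_add (η : ℝ) (u v : L2I) :
    scaledCoeff η (u + v) = scaledCoeff η u + scaledCoeff η v := by
  ext l
  simp [scaledCoeff, mul_add]

theorem scaledCoeff_smul (η c : ℝ) (u : L2I) :
    scaledCoeff η (c • u) = c • scaledCoeff η u := by
  ext l
  simp [scaledCoeff]
  ring

theorem scaledCoeff_sq (η : ℝ) (u : L2I) (l : ℕ) : scaledCoeff η u l ^ 2 = spectralTerm η u l := by
  rw [scaledCoeff, mul_pow, Real.sq_sqrt (one_add_rpow_nonneg η l), ← sqCoeff_eq_repr_sq,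
    spectralTerm_eq, mul_comm]

theorem memlp_two_iff_summable_sq {ι : Type*} (f : ι → ℝ) :
    Memℓp f 2 ↔ Summable fun i => f i ^ 2 := by
  rw [memℓp_gen_iff (by norm_num)]
  simp

theorem memlp_scaledCoeff_iff (η : ℝ) (u : L2I) :
    Memℓp (scaledCoeff η u) 2 ↔ Summable (spectralTerm η u) := by
  rw [memlp_two_iff_summable_sq]
  simp only [scaledCoeff_sq]

/-- The space `V^η` as a linear subspace, in terms of Legendre coefficients. -/
noncomputable def spectralSubmodule (η : ℝ) : Submodule ℝ L2I where
  carrier := {u | Memℓp (scaledCoeff η u) 2}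
  add_mem' {u v} hu hv := by
    change Memℓp (scaledCoeff η (u + v)) 2
    rw [scaledCoeff_add]
    exact hu.add hv
  zero_mem' := by
    change Memℓp (scaledCoeff η 0) 2
    have : scaledCoeff η 0 = 0 := by simpa using scaledCoeff_smul η 0 0
    rw [this]
    exact zero_memℓp
  smul_mem' c u hu := by
    change Memℓp (scaledCoeff η (c • u)) 2
    rw [scaledCoeff_smul]
    exact hu.const_smul c

/-- The scaled coefficients as a linear map to `ℓ²`. -/
noncomputable def spectralMap (η : ℝ) : spectralSubmodule η →ₗ[ℝ] lp (fun _ : ℕ => ℝ) 2 where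
  toFun u := ⟨scaledCoeff η u, u.2⟩
  map_add' u v := Subtype.ext (scaledCoeff_add η u v)
  map_smul' c u := Subtype.ext (scaledCoeff_smul η c u)

theorem norm_spectralMap_sq (η : ℝ) (u : spectralSubmodule η) :
    ‖spectralMap η u‖ ^ 2 = ∑' l, spectralTerm η u l := by
  rw [← real_inner_self_eq_norm_sq, lp.inner_eq_tsum]
  refine tsum_congr fun l => ?_
  rw [← scaledCoeff_sq]
  simp [spectralMap, sq]

theorem spectralMap_injective (η : ℝ) {u : spectralSubmodule η} (h : spectralMap η u = 0) :
    u = 0 := by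
  have h1 : ∀ l, scaledCoeff η u l = 0 := fun l => congrFun (congrArg Subtype.val h) l
  refine Subtype.ext (eq_zero_of_legendreCoeff_eq_zero fun l => ?_)
  have h2 := h1 l
  rw [scaledCoeff, legendreBasis_repr] at h2
  have h3 : 0 < 1 + (l : ℝ) ^ (2 * η) :=
    add_pos_of_pos_of_nonneg one_pos (Real.rpow_nonneg (by positivity) _)
  have h4 := (Real.sqrt_pos.2 h3).ne'
  have h5 : √((2 * (l : ℝ) + 1) / 2) ≠ 0 := by positivity
  exact ((mul_eq_zero.1 ((mul_eq_zero.1 h2).resolve_left h4)).resolve_left h5)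

theorem exists_equivalent_norm {η : ℝ} (hη : 0 ≤ η) :
    ∃ (S : Submodule ℝ L2I) (N : Seminorm ℝ S), (S : Set L2I) = spaceV η ∧
      (∀ u : S, N u = √(∑' l : ℕ, spectralTerm η u l)) ∧ (∀ u : S, N u = 0 → u = 0) ∧
      ∃ c C : ℝ, 0 < c ∧ 0 < C ∧ ∀ u : S, ENNReal.ofReal (c * N u ^ 2) ≤ normSqV η u ∧
        normSqV η u ≤ ENNReal.ofReal (C * N u ^ 2) := by
  obtain ⟨c, C, hc, hC, H⟩ := exists_normSqV_equiv hη
  -- `N_η` is the `ℓ²` norm pulled back along the scaled coefficients. The factor `1/2` in `c / 2`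
  -- comes from `1 + l^{2η} ≤ 2 max(1, l)^{2η}`.
  refine ⟨spectralSubmodule η, (normSeminorm ℝ _).comp (spectralMap η), ?_, fun u => ?_,
    fun u hu => spectralMap_injective η (norm_eq_zero.1 hu), c / 2, C, by positivity, hC,
    fun u => ?_⟩
  · ext u
    rw [mem_spaceV_iff_summable hη, ← memlp_scaledCoeff_iff]
    rfl
  · rw [← norm_spectralMap_sq, Real.sqrt_sq (norm_nonneg _)]
    rfl
  · have e : ((normSeminorm ℝ _).comp (spectralMap η)) u ^ 2 = ∑' l, spectralTerm η u l :=
      norm_spectralMap_sq η u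
    have hs : Summable (spectralTerm η u) := (memlp_scaledCoeff_iff η u).1 u.2
    rw [e, ENNReal.ofReal_mul (by positivity), ENNReal.ofReal_mul hC.le,
      ENNReal.ofReal_tsum_of_nonneg (spectralTerm_nonneg η u) hs]
    constructor
    · refine le_trans ?_ (H u).1
      calc _ ≤ ENNReal.ofReal (c / 2) * (ENNReal.ofReal 2 * specNormSq η u) := by
            gcongr
            exact tsum_spectralTerm_le hη u
        _ = ENNReal.ofReal c * specNormSq η u := by
            rw [← mul_assoc, ← ENNReal.ofReal_mul (by positivity)]
            congr 2
            ring
    · refine (H u).2.trans ?_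
      gcongr
      exact specNormSq_le_tsum_spectralTerm η u

/-! ### Equivalence of the kernel conditions -/

theorem seminormSq_congr (j : ℕ) {u v : ℝ → ℝ} (h : u =ᵐ[volI] v) :
    seminormSq j u = seminormSq j v := by
  unfold seminormSq
  refine iInf_congr fun g => iInf_congr_Prop ⟨fun H => H.congr h EventuallyEq.rfl,
    fun H => H.congr h.symm EventuallyEq.rfl⟩ fun _ => rfl

theorem seminormSq_lt_top_iff (n : ℕ) (u : ℝ → ℝ) :
    seminormSq n u < ⊤ ↔ ∃ g : ℝ → ℝ, HasWeakDeriv n u g ∧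
      MemLp (fun x => (1 - x ^ 2) ^ ((n : ℝ) / 2) * g x) 2 volI := by
  unfold seminormSq
  simp only [iInf_lt_iff, exists_prop]
  refine exists_congr fun g => and_congr_right fun hg => ?_
  rw [← memLp_sqrt_weight_mul_iff n hg.aestronglyMeasurable]
  refine memLp_congr_ae ?_
  filter_upwards [ae_restrict_mem measurableSet_Ioo] with x hx
  rw [Real.sqrt_eq_rpow, ← Real.rpow_mul_natCast (one_sub_sq_pos hx).le]
  congr 2
  ring

theorem seminormSq_lt_top_iff_summable (n : ℕ) (u : L2I) :
    seminormSq n u < ⊤ ↔ Summable fun l => sqCoeff u l * wt l n := by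
  rw [seminormSq_eq_tsum, summable_iff_tsum_ofReal_lt_top]
  exact fun l => mul_nonneg (sqCoeff_nonneg u l) (wt_nonneg l n)

theorem freq_pow_of_le {n l : ℕ} (h : n ≤ l) : freq l ^ (2 * n) = (l : ℝ) ^ (2 * n) := by
  rcases Nat.eq_zero_or_pos l with rfl | hl
  · obtain rfl : n = 0 := by omega
    simp
  · rw [freq_of_pos hl]

/-- For `l ≥ n` the two weights are comparable, and `wt l n` vanishes for `l < n`, so the full sum
is a sum over the subtype. -/
theorem summable_subtype_iff_summable_wt (n : ℕ) (u : L2I) :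
    Summable (fun l : {l : ℕ // n ≤ l} => sqCoeff u l * ((l : ℕ) : ℝ) ^ (2 * n)) ↔
      Summable fun l => sqCoeff u l * wt l n := by
  rw [← Function.Injective.summable_iff (f := fun l => sqCoeff u l * wt l n)
    (Subtype.val_injective (p := fun l : ℕ => n ≤ l))]
  · constructor <;> intro h
    · refine Summable.of_nonneg_of_le
        (fun l => mul_nonneg (sqCoeff_nonneg u l) (wt_nonneg _ _)) (fun l => ?_)
        (h.mul_left (2 ^ n))
      have := mul_le_mul_of_nonneg_left (wt_le l n) (sqCoeff_nonneg u l)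
      rw [freq_pow_of_le l.2] at this
      simp only [Function.comp]
      linarith
    · refine Summable.of_nonneg_of_le
        (fun l => mul_nonneg (sqCoeff_nonneg u l) (by positivity)) (fun l => ?_)
        (h.mul_left (n.factorial : ℝ))
      have := mul_le_mul_of_nonneg_left (pow_le_factorial_mul_wt l.2) (sqCoeff_nonneg u l)
      simp only [Function.comp]
      linarith
  · intro l hl
    have : l < n := by
      by_contra h
      exact hl ⟨⟨l, not_lt.1 h⟩, rfl⟩
    rw [wt_eq_zero this, mul_zero]

/-- The top seminorm suffices for membership, since the squared coefficients of an `L²` function are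
summable and supply the `1` in `1 + wt l n`. -/
theorem mem_spaceV_natCast_iff (n : ℕ) (u : L2I) :
    u ∈ spaceV n ↔ Summable fun l => sqCoeff u l * wt l n := by
  have hnn : ∀ l, 0 ≤ sqCoeff u l * freq l ^ (2 * n) := fun l =>
    mul_nonneg (sqCoeff_nonneg u l) (pow_nonneg (freq_pos l).le _)
  rw [mem_spaceV_iff_specNormSq (by positivity), specNormSq]
  simp only [freq_rpow_natCast]
  rw [← summable_iff_tsum_ofReal_lt_top hnn]
  constructor <;> intro h
  · refine Summable.of_nonneg_of_le
      (fun l => mul_nonneg (sqCoeff_nonneg u l) (wt_nonneg _ _)) (fun l => ?_) (h.mul_left (2 ^ n))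
    have := mul_le_mul_of_nonneg_left (wt_le l n) (sqCoeff_nonneg u l)
    linarith
  · obtain ⟨c, hc, H⟩ := exists_le_one_add_wt n
    refine Summable.of_nonneg_of_le hnn (fun l => ?_)
      (((summable_sqCoeff u).add h).mul_left c⁻¹)
    rw [le_inv_mul_iff₀ hc]
    have := mul_le_mul_of_nonneg_left (H l) (sqCoeff_nonneg u l)
    linarith

theorem memlp_iff_summable_powerSpectrum (A : ℕ → ℝ) (n : ℕ) :
    Memℓp (fun l : {l : ℕ // n ≤ l} => ((l : ℕ) : ℝ) ^ ((n : ℝ) + 1 / 2) * A l) 2 ↔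
      Summable (fun l : {l : ℕ // n ≤ l} => 1 / (4 * Real.pi) ^ 2 *
          (A l ^ 2 * ((2 * ((l : ℕ) : ℝ) + 1) / 2) * ((l : ℕ) : ℝ) ^ (2 * n))) := by
  have hκ : 1 / (4 * Real.pi) ^ 2 ≠ 0 := by positivity
  rw [memlp_two_iff_summable_sq, summable_mul_left_iff hκ]
  have e : ∀ l : ℕ, ((l : ℝ) ^ ((n : ℝ) + 1 / 2) * A l) ^ 2 =
      A l ^ 2 * l * (l : ℝ) ^ (2 * n) := by
    intro l
    rw [mul_pow, ← Real.rpow_mul_natCast (by positivity)]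
    have : ((n : ℝ) + 1 / 2) * (2 : ℕ) = ((2 * n + 1 : ℕ) : ℝ) := by push_cast; ring
    rw [this, Real.rpow_natCast]
    ring
  simp only [e]
  constructor <;> intro h
  -- `(2l+1)/2 ≤ 2l` fails only at `l = 0`, an index present only for `n = 0`; one term does not
  -- affect summability.
  · refine Summable.of_norm_bounded_eventually (h.mul_left 2) ?_
    refine Set.Finite.subset (s := {l : {l : ℕ // n ≤ l} | (l : ℕ) = 0}) ?_ ?_
    · exact Set.Subsingleton.finite fun a ha b hb => Subtype.ext (ha.trans hb.symm)
    · intro l hl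
      by_contra h0
      refine hl ?_
      have h1 : (1 : ℝ) ≤ ((l : ℕ) : ℝ) := by exact_mod_cast Nat.one_le_iff_ne_zero.2 h0
      have h2 : 0 ≤ A l ^ 2 * ((l : ℕ) : ℝ) ^ (2 * n) := by positivity
      change ‖_‖ ≤ _
      rw [Real.norm_of_nonneg (by positivity)]
      nlinarith
  · refine Summable.of_nonneg_of_le (fun l => by positivity) (fun l => ?_) h
    have h2 : 0 ≤ A l ^ 2 * ((l : ℕ) : ℝ) ^ (2 * n) := by positivity
    nlinarith

theorem tfae_kernel {k : ℝ → ℝ} (hk : MemLp k 2 volI) {A : ℕ → ℝ}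
    (hA : ∀ l, A l = 2 * Real.pi * legendreCoeff (hk.toLp k) l) (n : ℕ) :
    List.TFAE [
        Memℓp (fun l : {l : ℕ // n ≤ l} => ((l : ℕ) : ℝ) ^ ((n : ℝ) + 1 / 2) * A l) 2,
        Summable (fun l : {l : ℕ // n ≤ l} => 1 / (4 * Real.pi) ^ 2 *
          (A l ^ 2 * ((2 * ((l : ℕ) : ℝ) + 1) / 2) * ((l : ℕ) : ℝ) ^ (2 * n))),
        ∃ g : ℝ → ℝ, HasWeakDeriv n k g ∧
          MemLp (fun x => (1 - x ^ 2) ^ ((n : ℝ) / 2) * g x) 2 volI,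
        seminormSq n k < ⊤,
        hk.toLp k ∈ spaceV n] := by
  tfae_have 1 ↔ 2 := memlp_iff_summable_powerSpectrum A n
  tfae_have 4 ↔ 3 := seminormSq_lt_top_iff n k
  tfae_have 4 ↔ 5 := by
    rw [mem_spaceV_natCast_iff, ← seminormSq_congr n hk.coeFn_toLp,
      seminormSq_lt_top_iff_summable]
  tfae_have 2 ↔ 5 := by
    rw [mem_spaceV_natCast_iff, ← summable_subtype_iff_summable_wt,
      -- With `A_l = 2π u_l`, the prefactor `1/(4π)²` leaves `u_l² / 4`.
      ← summable_mul_left_iff (a := (1 / 4 : ℝ))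
        (f := fun l : {l : ℕ // n ≤ l} => sqCoeff _ l * _) (by norm_num)]
    refine summable_congr fun l => ?_
    rw [hA, sqCoeff]
    field_simp
    ring
  tfae_finish

/-! ### Covariance kernels with a given power spectrum -/

theorem continuous_kernelI {A : ℕ → ℝ} (hA : ∀ l, 0 ≤ A l)
    (hs : Summable fun l : ℕ => A l * (2 * (l : ℝ) + 1)) : Continuous (kernelI A) := by
  refine Continuous.comp (g := kernelDist A) ?_ Real.continuous_arccos
  refine continuous_tsum (fun l => ?_) (hs.div_const (4 * Real.pi)) fun l r => ?_
  · exact continuous_const.mul ((legendreP l).continuous.comp Real.continuous_cos)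
  · have h1 := abs_legendreP_eval_le_one l (Real.cos_mem_Icc r)
    have h2 := hA l
    have h3 : 0 ≤ A l * ((2 * (l : ℝ) + 1) / (4 * Real.pi)) := by positivity
    rw [norm_mul, Real.norm_of_nonneg h3, mul_div_assoc]
    exact mul_le_of_le_one_right h3 h1

theorem memLp_kernelI {A : ℕ → ℝ} (hA : ∀ l, 0 ≤ A l)
    (hs : Summable fun l : ℕ => A l * (2 * (l : ℝ) + 1)) : MemLp (kernelI A) 2 volI := by
  have hc := continuous_kernelI hA hs
  obtain ⟨M, hM⟩ := isCompact_Icc.exists_bound_of_continuousOn (s := Icc (-1 : ℝ) 1)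
    hc.continuousOn
  refine MemLp.of_bound hc.aestronglyMeasurable M ?_
  filter_upwards [ae_restrict_mem measurableSet_Ioo] with x hx
  exact hM x (Ioo_subset_Icc_self hx)

theorem hasSum_kernelI {A : ℕ → ℝ} (hA : ∀ l, 0 ≤ A l)
    (hs : Summable fun l : ℕ => A l * (2 * (l : ℝ) + 1)) {x : ℝ} (hx : x ∈ Icc (-1 : ℝ) 1) :
    HasSum (fun l : ℕ => A l * ((2 * (l : ℝ) + 1) / (4 * Real.pi)) * (legendreP l).eval x)
      (kernelI A x) := by
  unfold kernelI kernelDist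
  rw [Real.cos_arccos hx.1 hx.2]
  refine Summable.hasSum (Summable.of_norm_bounded (hs.div_const (4 * Real.pi)) fun l => ?_)
  have h1 := abs_legendreP_eval_le_one l hx
  have h2 := hA l
  have h3 : 0 ≤ A l * ((2 * (l : ℝ) + 1) / (4 * Real.pi)) := by positivity
  rw [norm_mul, Real.norm_of_nonneg h3, mul_div_assoc]
  exact mul_le_of_le_one_right h3 h1

/-- Termwise integration, dominated by the summable constants `A_l (2l+1)/(4π)`. Orthogonality
leaves the term `l = m`, namely `A_m (2m+1)/(4π) · 2/(2m+1) = A_m/(2π)`. -/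
theorem legendreCoeff_kernelI {A : ℕ → ℝ} (hA : ∀ l, 0 ≤ A l)
    (hs : Summable fun l : ℕ => A l * (2 * (l : ℝ) + 1)) (hk : MemLp (kernelI A) 2 volI) (m : ℕ) :
    A m = 2 * Real.pi * legendreCoeff (hk.toLp (kernelI A)) m := by
  have e : legendreCoeff (hk.toLp (kernelI A)) m =
      ∫ x in Ioo (-1 : ℝ) 1, kernelI A x * (legendreP m).eval x := by
    refine integral_congr_ae ?_
    filter_upwards [hk.coeFn_toLp] with x hx
    rw [hx]
  have S : HasSum (fun l : ℕ => ∫ x in Ioo (-1 : ℝ) 1,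
      A l * ((2 * (l : ℝ) + 1) / (4 * Real.pi)) * (legendreP l).eval x * (legendreP m).eval x)
      (∫ x in Ioo (-1 : ℝ) 1, kernelI A x * (legendreP m).eval x) := by
    refine hasSum_integral_of_dominated_convergence
      (fun l _ => A l * (2 * (l : ℝ) + 1) / (4 * Real.pi)) (fun l => ?_) (fun l => ?_)
      (Eventually.of_forall fun _ => hs.div_const _) (integrable_const _) ?_
    · exact ((continuous_const.mul (legendreP l).continuous).mul
        (legendreP m).continuous).aestronglyMeasurable
    · filter_upwards [ae_restrict_mem measurableSet_Ioo] with x hx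
      have h1 := abs_legendreP_eval_le_one l (Ioo_subset_Icc_self hx)
      have h1' := abs_legendreP_eval_le_one m (Ioo_subset_Icc_self hx)
      have h2 := hA l
      have h3 : 0 ≤ A l * ((2 * (l : ℝ) + 1) / (4 * Real.pi)) := by positivity
      rw [norm_mul, norm_mul, Real.norm_of_nonneg h3, mul_div_assoc, mul_assoc]
      exact mul_le_of_le_one_right h3 (mul_le_one₀ h1 (norm_nonneg _) h1')
    · filter_upwards [ae_restrict_mem measurableSet_Ioo] with x hx
      exact (hasSum_kernelI hA hs (Ioo_subset_Icc_self hx)).mul_right _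
  have T : ∀ l : ℕ, ∫ x in Ioo (-1 : ℝ) 1,
      A l * ((2 * (l : ℝ) + 1) / (4 * Real.pi)) * (legendreP l).eval x * (legendreP m).eval x =
      A l * ((2 * (l : ℝ) + 1) / (4 * Real.pi)) *
        ∫ x in Ioo (-1 : ℝ) 1, (legendreP l * legendreP m).eval x := by
    intro l
    rw [← integral_const_mul]
    simp only [eval_mul, mul_assoc]
  simp only [T] at S
  have U := S.unique (hasSum_single m fun l hl => by
    rw [setIntegral_legendreP_mul_of_ne hl, mul_zero])
  rw [e, U, setIntegral_legendreP_mul_self]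
  have : (2 * (m : ℝ) + 1) ≠ 0 := by positivity
  field_simp
  norm_num

end LegendreSobolev

theorem mainTheorem3 :
    -- membership in `V^η`, and the equivalent norm
    (∀ η : ℝ, 0 ≤ η →
      (∀ u : LegendreSobolev.L2I,
        u ∈ LegendreSobolev.spaceV η ↔ Summable (LegendreSobolev.spectralTerm η u)) ∧
      ∃ (S : Submodule ℝ LegendreSobolev.L2I) (N : Seminorm ℝ S),
        (S : Set LegendreSobolev.L2I) = LegendreSobolev.spaceV η ∧
        (∀ u : S, N u = Real.sqrt (∑' l : ℕ, LegendreSobolev.spectralTerm η u l)) ∧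
        (∀ u : S, N u = 0 → u = 0) ∧
        ∃ c C : ℝ, 0 < c ∧ 0 < C ∧ ∀ u : S,
          ENNReal.ofReal (c * N u ^ 2) ≤ LegendreSobolev.normSqV η u ∧
          LegendreSobolev.normSqV η u ≤ ENNReal.ofReal (C * N u ^ 2)) ∧
    -- covariance kernels of isotropic random fields, given by their angular power spectrum
    (∀ A : ℕ → ℝ, (∀ l, 0 ≤ A l) → Summable (fun l : ℕ => A l * (2 * (l : ℝ) + 1)) →
      MemLp (LegendreSobolev.kernelI A) 2 LegendreSobolev.volI ∧
      ∀ n : ℕ, List.TFAE [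
        Memℓp (fun l : {l : ℕ // n ≤ l} => ((l : ℕ) : ℝ) ^ ((n : ℝ) + 1 / 2) * A l) 2,
        Summable (fun l : {l : ℕ // n ≤ l} => 1 / (4 * Real.pi) ^ 2 *
          (A l ^ 2 * ((2 * ((l : ℕ) : ℝ) + 1) / 2) * ((l : ℕ) : ℝ) ^ (2 * n))),
        ∃ g : ℝ → ℝ, LegendreSobolev.HasWeakDeriv n (LegendreSobolev.kernelI A) g ∧
          MemLp (fun x => (1 - x ^ 2) ^ ((n : ℝ) / 2) * g x) 2 LegendreSobolev.volI,
        LegendreSobolev.seminormSq n (LegendreSobolev.kernelI A) < ⊤,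
        ∃ hk : MemLp (LegendreSobolev.kernelI A) 2 LegendreSobolev.volI,
          hk.toLp (LegendreSobolev.kernelI A) ∈ LegendreSobolev.spaceV n]) ∧
    -- the same for an arbitrary kernel in `L²(-1, 1)`, with `A_ℓ = 2π u_ℓ`
    (∀ (u : LegendreSobolev.L2I) (A : ℕ → ℝ),
      (∀ l, A l = 2 * Real.pi * LegendreSobolev.legendreCoeff u l) →
      ∀ n : ℕ, List.TFAE [
        Memℓp (fun l : {l : ℕ // n ≤ l} => ((l : ℕ) : ℝ) ^ ((n : ℝ) + 1 / 2) * A l) 2,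
        Summable (fun l : {l : ℕ // n ≤ l} => 1 / (4 * Real.pi) ^ 2 *
          (A l ^ 2 * ((2 * ((l : ℕ) : ℝ) + 1) / 2) * ((l : ℕ) : ℝ) ^ (2 * n))),
        ∃ g : ℝ → ℝ, LegendreSobolev.HasWeakDeriv n u g ∧
          MemLp (fun x => (1 - x ^ 2) ^ ((n : ℝ) / 2) * g x) 2 LegendreSobolev.volI,
        LegendreSobolev.seminormSq n u < ⊤,
        u ∈ LegendreSobolev.spaceV n]) := by
  refine ⟨fun η hη => ⟨fun u => LegendreSobolev.mem_spaceV_iff_summable hη u,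
    LegendreSobolev.exists_equivalent_norm hη⟩, fun A hA hs => ?_, fun u A hA n => ?_⟩
  · have hk := LegendreSobolev.memLp_kernelI hA hs
    refine ⟨hk, fun n => ?_⟩
    have h := LegendreSobolev.tfae_kernel hk (LegendreSobolev.legendreCoeff_kernelI hA hs hk) n
    rwa [← exists_prop_of_true (p := MemLp (LegendreSobolev.kernelI A) 2 LegendreSobolev.volI)
      (q := fun hk => hk.toLp (LegendreSobolev.kernelI A) ∈ LegendreSobolev.spaceV n) hk] at h
  · have h := LegendreSobolev.tfae_kernel (k := u) (Lp.memLp u) (A := A)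
      (by rw [Lp.toLp_coeFn]; exact hA) n
    rwa [Lp.toLp_coeFn] at h
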